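/- Let $\nu\in\mathbb C$, and let $P_\nu$ be the Legendre function of the first kind, $P_\nu(z)={}_2F_1(-\nu,\nu+1;1;\tfrac{1-z}{2})$, considered for $z>0$ (on and off the cut; continued analytically for large $z$). For functions $f$ on $(0,\infty)$ the zero-order-of-smoothness Buschman–Erdélyi operators are $$({}_1S_{0+}^{\nu}f)(x)=\frac{d}{dx}\int_0^x P_\nu\!\left(\tfrac xt\right)f(t)\,dt,\qquad ({}_1P_{0+}^{\nu}f)(x)=\int_0^x P_\nu\!\left(\tfrac tx\right)f'(t)\,dt,$$ $$({}_1P_{-}^{\nu}f)(x)=\int_x^\infty P_\nu\!\left(\tfrac tx\right)(-f'(t))\,dt,\qquad ({}_1S_{-}^{\nu}f)(x)=-\frac{d}{dx}\int_x^\infty P_\nu\!\left(\tfrac xt\right)f(t)\,dt.$$ The domain of ${}_1S_{0+}^\nu$ and of ${}_1S_-^\nu$ consists of the $f$ for which the integral converges absolutely for all $x>0$. The domain of ${}_1P_{0+}^\nu$ (of ${}_1P_-^\nu$) consists of the locally absolutely continuous $f$ for which the integral converges absolutely and $P_\nu(t/x)f(t)\to0$ as $t\to0+$ (as $t\to\infty$),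 for all $x>0$. Write $M[f](s)=\int_0^\infty x^{s-1}f(x)\,dx$ (absolutely convergent integral) and $(k*f)(x)=\int_0^\infty k(x/y)f(y)\,\frac{dy}{y}$. Each of these operators $A$ is a Mellin convolution with a kernel $K_A=\delta_1+k_A$, where $\delta_1$ is the unit mass at $1$ and $$k_{{}_1S_{0+}^\nu}(u)=P_\nu'(u)\mathbf 1_{u>1},\quad k_{{}_1P_{0+}^\nu}(u)=-\tfrac1uP_\nu'(\tfrac1u)\mathbf 1_{u>1},\quad k_{{}_1P_-^\nu}(u)=\tfrac1uP_\nu'(\tfrac1u)\mathbf 1_{0<u<1},\quad k_{{}_1S_-^\nu}(u)=-P_\nu'(u)\mathbf 1_{0<u<1}.$$ Precisely: let $H_A$ be the half-plane given for $A$ below and $s\in H_A$. Then the Mellin transform $m_A(s)=M[K_A](s)=1+M[k_A](s)$ converges absolutely, and for every $f$ in the domain of $A$ whose Mellin transform converges absolutely at $s$: the integral $(k_A*f)(x)$ converges absolutely for all $x>0$; $Af=f+k_A*f$ almost everywhere on $(0,\infty)$ (for ${}_1S_{0+}^\nu$, ${}_1S_-^\nu$ the derivative in the definition exists almost everywhere);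 $M[Af](s)$ converges absolutely; and $$M[Af](s)=m_A(s)\,M[f](s).$$ The multipliers are, with $1/\Gamma=0$ at the poles of $\Gamma$, $$m_{{}_1S_{0+}^{\nu}}(s)=\frac{\Gamma(-\frac s2+\frac\nu2+1)\,\Gamma(-\frac s2-\frac\nu2+\frac12)}{\Gamma(\frac12-\frac s2)\,\Gamma(1-\frac s2)}=\frac{2^{-s}}{\sqrt\pi}\,\frac{\Gamma(-\frac s2-\frac\nu2+\frac12)\,\Gamma(-\frac s2+\frac\nu2+1)}{\Gamma(1-s)},\quad \operatorname{Re}s<\min(2+\operatorname{Re}\nu,\,1-\operatorname{Re}\nu);$$ $$m_{{}_1P_{0+}^{\nu}}(s)=\frac{\Gamma(\frac12-\frac s2)\,\Gamma(1-\frac s2)}{\Gamma(-\frac s2+\frac\nu2+1)\,\Gamma(-\frac s2-\frac\nu2+\frac12)},\quad \operatorname{Re}s<1;$$ $$m_{{}_1P_{-}^{\nu}}(s)=\frac{\Gamma(\frac s2+\frac\nu2+\frac12)\,\Gamma(\frac s2-\frac\nu2)}{\Gamma(\frac s2)\,\Gamma(\frac s2+\frac12)},\quad \operatorname{Re}s>\max(\operatorname{Re}\nu,\,-1-\operatorname{Re}\nu);$$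 $$m_{{}_1S_{-}^{\nu}}(s)=\frac{\Gamma(\frac s2)\,\Gamma(\frac s2+\frac12)}{\Gamma(\frac s2+\frac\nu2+\frac12)\,\Gamma(\frac s2-\frac\nu2)},\quad \operatorname{Re}s>0.$$ Moreover $$m_{{}_1P_{0+}^\nu}(s)=\frac1{m_{{}_1S_{0+}^\nu}(s)},\qquad m_{{}_1P_-^\nu}(s)=\frac1{m_{{}_1S_-^\nu}(s)},\qquad m_{{}_1P_-^\nu}(s)=m_{{}_1S_{0+}^\nu}(1-s),\qquad m_{{}_1P_{0+}^\nu}(s)=m_{{}_1S_-^\nu}(1-s)$$ for all $s$ for which the points concerned lie in the respective half-planes (in the first two, the denominators do not vanish there; in the last two, $1-s$ lies in the half-plane of the right-hand side whenever $s$ lies in that of the left-hand side), and these relations hold on all of $\mathbb C$ for the meromorphic continuations given by the gamma ratios. -/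

import Mathlib

open Set Filter Topology MeasureTheory

noncomputable section

namespace BuschmanErdelyi

/-- The Legendre function of the first kind `P_ν(z) = ₂F₁(-ν, ν+1; 1; (1-z)/2)` of complex degree
`ν`, for real `z > 0`. It is written in the form
`((1+z)/2)^ν ₂F₁(-ν, -ν; 1; (z-1)/(z+1))` (Pfaff's transformation), because for every `z > 0` the
last argument lies in `(-1, 1)`, where the hypergeometric series converges; so the same formula
gives the function on the cut (`0 < z < 1`) and off the cut (`1 ≤ z`). -/
def legendreP (ν : ℂ) (z : ℝ) : ℂ :=
  (((1 + z) / 2 : ℝ) : ℂ) ^ ν * ordinaryHypergeometric (-ν) (-ν) (1 : ℂ) (((z - 1) / (z + 1) : ℝ) : ℂ)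

/-! ### The four operators -/

/-- `₁S_{0+}^ν f (x) = d/dx ∫_0^x P_ν(x/t) f(t) dt`. -/
def opSzero (ν : ℂ) (f : ℝ → ℂ) (x : ℝ) : ℂ :=
  deriv (fun z : ℝ => ∫ t in Ioc 0 z, legendreP ν (z / t) * f t) x

/-- `₁P_{0+}^ν f (x) = ∫_0^x P_ν(t/x) f'(t) dt`. -/
def opPzero (ν : ℂ) (f : ℝ → ℂ) (x : ℝ) : ℂ :=
  ∫ t in Ioc 0 x, legendreP ν (t / x) * deriv f t

/-- `₁P_{-}^ν f (x) = ∫_x^∞ P_ν(t/x) (-f'(t)) dt`. -/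
def opPminus (ν : ℂ) (f : ℝ → ℂ) (x : ℝ) : ℂ :=
  ∫ t in Ioi x, legendreP ν (t / x) * (-deriv f t)

/-- `₁S_{-}^ν f (x) = -d/dx ∫_x^∞ P_ν(x/t) f(t) dt`. -/
def opSminus (ν : ℂ) (f : ℝ → ℂ) (x : ℝ) : ℂ :=
  -deriv (fun z : ℝ => ∫ t in Ioi z, legendreP ν (z / t) * f t) x

/-! ### Their domains -/

/-- `f` is locally absolutely continuous on `(0, ∞)`. -/
def LocallyAC (f : ℝ → ℂ) : Prop :=
  ∀ a b : ℝ, 0 < a → a < b → AbsolutelyContinuousOnInterval f a b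

/-- The integral in `₁S_{0+}^ν f (x)` converges absolutely for every `x > 0`. -/
def domSzero (ν : ℂ) : Set (ℝ → ℂ) :=
  {f | ∀ x : ℝ, 0 < x → IntegrableOn (fun t => legendreP ν (x / t) * f t) (Ioc 0 x)}

/-- `f` is locally absolutely continuous, the integral in `₁P_{0+}^ν f (x)` converges absolutely
and the boundary term `P_ν(t/x) f(t)` vanishes as `t → 0+`, for every `x > 0`. -/
def domPzero (ν : ℂ) : Set (ℝ → ℂ) :=
  {f | LocallyAC f ∧ ∀ x : ℝ, 0 < x →
    IntegrableOn (fun t => legendreP ν (t / x) * deriv f t) (Ioc 0 x) ∧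
    Tendsto (fun t => legendreP ν (t / x) * f t) (𝓝[>] 0) (𝓝 0)}

/-- `f` is locally absolutely continuous, the integral in `₁P_{-}^ν f (x)` converges absolutely
and the boundary term `P_ν(t/x) f(t)` vanishes as `t → ∞`, for every `x > 0`. -/
def domPminus (ν : ℂ) : Set (ℝ → ℂ) :=
  {f | LocallyAC f ∧ ∀ x : ℝ, 0 < x →
    IntegrableOn (fun t => legendreP ν (t / x) * (-deriv f t)) (Ioi x) ∧
    Tendsto (fun t => legendreP ν (t / x) * f t) atTop (𝓝 0)}

/-- The integral in `₁S_{-}^ν f (x)` converges absolutely for every `x > 0`. -/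
def domSminus (ν : ℂ) : Set (ℝ → ℂ) :=
  {f | ∀ x : ℝ, 0 < x → IntegrableOn (fun t => legendreP ν (x / t) * f t) (Ioi x)}

/-! ### Mellin convolutions

The kernel of each operator is `K = δ₁ + k`, where `δ₁` is the unit point mass at `1` (the unit of
the Mellin convolution, with Mellin transform `1`) and `k` is a function on `(0, ∞)`. -/

/-- `(k * f)(x) = ∫_0^∞ k(x/y) f(y) dy/y`. -/
def mellinConv (k f : ℝ → ℂ) (x : ℝ) : ℂ :=
  ∫ y in Ioi (0 : ℝ), k (x / y) * f y / (y : ℂ)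

/-- The Mellin transform of `δ₁ + k`. -/
def multiplier (k : ℝ → ℂ) (s : ℂ) : ℂ := 1 + mellin k s

/-- The operator `A`, with domain `D`, is the Mellin convolution with the kernel `δ₁ + k`, whose
Mellin transform converges in `H`; and for `s ∈ H` it acts under the Mellin transform as the
multiplication by the Mellin transform of its kernel. -/
def ActsAsMellinConvolution (A : (ℝ → ℂ) → ℝ → ℂ) (D : Set (ℝ → ℂ)) (k : ℝ → ℂ) (H : Set ℂ) :
    Prop :=
  ∀ s ∈ H, MellinConvergent k s ∧
    ∀ f ∈ D, MellinConvergent f s →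
      (∀ x : ℝ, 0 < x → IntegrableOn (fun y : ℝ => k (x / y) * f y / (y : ℂ)) (Ioi 0)) ∧
      (∀ᵐ x ∂(volume.restrict (Ioi (0 : ℝ))), A f x = f x + mellinConv k f x) ∧
      MellinConvergent (A f) s ∧
      mellin (A f) s = multiplier k s * mellin f s

/-- The function part of the kernel of `₁S_{0+}^ν`. -/
def kerSzero (ν : ℂ) (u : ℝ) : ℂ := if 1 < u then deriv (legendreP ν) u else 0

/-- The function part of the kernel of `₁P_{0+}^ν`. -/
def kerPzero (ν : ℂ) (u : ℝ) : ℂ := if 1 < u then -(deriv (legendreP ν) (1 / u) / (u : ℂ)) else 0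

/-- The function part of the kernel of `₁P_{-}^ν`. -/
def kerPminus (ν : ℂ) (u : ℝ) : ℂ :=
  if 0 < u ∧ u < 1 then deriv (legendreP ν) (1 / u) / (u : ℂ) else 0

/-- The function part of the kernel of `₁S_{-}^ν`. -/
def kerSminus (ν : ℂ) (u : ℝ) : ℂ :=
  if 0 < u ∧ u < 1 then -deriv (legendreP ν) u else 0

/-! ### The half-planes -/

def halfSzero (ν : ℂ) : Set ℂ := {s | s.re < min (2 + ν.re) (1 - ν.re)}

def halfPzero : Set ℂ := {s | s.re < 1}

def halfPminus (ν : ℂ) : Set ℂ := {s | max ν.re (-1 - ν.re) < s.re}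

def halfSminus : Set ℂ := {s | 0 < s.re}

/-! ### The gamma ratios

`Complex.Gamma` and the division have the value `0` at a pole and at a zero denominator, so a
ratio is `0`, as it should be, where only its denominator has a pole. -/

def gammaSzero (ν s : ℂ) : ℂ :=
  Complex.Gamma (-s / 2 + ν / 2 + 1) * Complex.Gamma (-s / 2 - ν / 2 + 1 / 2) /
    (Complex.Gamma (1 / 2 - s / 2) * Complex.Gamma (1 - s / 2))

def gammaPzero (ν s : ℂ) : ℂ :=
  Complex.Gamma (1 / 2 - s / 2) * Complex.Gamma (1 - s / 2) /
    (Complex.Gamma (-s / 2 + ν / 2 + 1) * Complex.Gamma (-s / 2 - ν / 2 + 1 / 2))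

def gammaPminus (ν s : ℂ) : ℂ :=
  Complex.Gamma (s / 2 + ν / 2 + 1 / 2) * Complex.Gamma (s / 2 - ν / 2) /
    (Complex.Gamma (s / 2) * Complex.Gamma (s / 2 + 1 / 2))

def gammaSminus (ν s : ℂ) : ℂ :=
  Complex.Gamma (s / 2) * Complex.Gamma (s / 2 + 1 / 2) /
    (Complex.Gamma (s / 2 + ν / 2 + 1 / 2) * Complex.Gamma (s / 2 - ν / 2))

end BuschmanErdelyi

end

/-! Each operator is the identity plus a convolution because `P_ν(1) = 1`. For the operators `₁P`,
integration by parts moves the derivative from `f` to `P_ν`: the boundary term at `t = x` is `f(x)`,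
the remaining integral is `k * f`. For the operators `₁S`, the integrand has the kernel `P_ν` cut
off at `1`, whose distributional derivative is the unit mass of the jump plus `P_ν'`; Fubini and
Lebesgue differentiation make this precise (`ae_hasDerivAt_mellin_primitive`).

Everything analytic rests on two bounds. For `r > max (Re ν) (-1 - Re ν)` and `z ≥ 1`, `P_ν =
O(z^r)` and `P_ν' = O(z^(r-1))`, since the hypergeometric series is dominated by a binomial series.
On `(0, 1]` both functions are bounded, by Grönwall's inequality for Legendre's equation. Hence `k`
has a Mellin transform in the half-plane and satisfies `‖k u‖ ≤ C u^(-Re s)`, so that `k * f`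
converges at every point and Fubini gives the product rule.

The multipliers are found without evaluating an integral. Legendre's equation yields a total
derivative that connects the Mellin integrals of `P_ν'` at `s` and `s + 2`; the boundary value at `u
= 1` is absorbed by the unit mass, leaving a homogeneous two-term recurrence for `m`. As `s` moves
into the half-plane in steps of `2`, dominated convergence gives `m → 1`. Euler's limit for `Γ`
turns the resulting infinite product into the gamma ratio (`eq_Gamma_ratio_of_recurrence`). This is
done for the two `₁S` kernels; the `₁P` kernels follow by `u ↦ 1/u`, which exchanges `s` and `1 -
s`. -/

namespace BuschmanErdelyi

/-! ### The binomial series as a majorant -/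

/-- The coefficients of the binomial series `(1 - x) ^ (-p)`. -/
noncomputable def binomCoeff (p : ℝ) (n : ℕ) : ℝ := Ring.choose (p + n - 1) n

theorem hasSum_binomCoeff (p : ℝ) {x : ℝ} (hx : |x| < 1) :
    HasSum (fun n => binomCoeff p n * x ^ n) ((1 - x) ^ (-p)) := by
  have h := (Real.one_div_one_sub_rpow_hasFPowerSeriesOnBall_zero p).hasSum (y := x)
    (by simpa [enorm_eq_nnnorm, ← NNReal.coe_lt_one] using hx)
  simp only [zero_add, FormalMultilinearSeries.ofScalars_apply_eq, smul_eq_mul, one_div] at h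
  rwa [← Real.rpow_neg (by linarith [(abs_lt.1 hx).2])] at h

theorem binomCoeff_eq (p : ℝ) (n : ℕ) :
    binomCoeff p n = (ascPochhammer ℝ n).eval p / n.factorial := by
  have h := Ring.factorial_nsmul_multichoose_eq_ascPochhammer p n
  rw [Polynomial.ascPochhammer_smeval_eq_eval, nsmul_eq_mul] at h
  rw [binomCoeff, Ring.choose, show p + n - 1 - n + 1 = p by ring, ← h]
  field_simp

theorem binomCoeff_pos {p : ℝ} (hp : 0 < p) (n : ℕ) : 0 < binomCoeff p n := by
  rw [binomCoeff_eq]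
  exact div_pos (ascPochhammer_pos n p hp) (by positivity)

theorem binomCoeff_succ (p : ℝ) (n : ℕ) :
    (n + 1) * binomCoeff p (n + 1) = (p + n) * binomCoeff p n := by
  rw [binomCoeff_eq, binomCoeff_eq, ascPochhammer_succ_eval, Nat.factorial_succ]
  push_cast
  field_simp

theorem binomCoeff_succ' (p : ℝ) (n : ℕ) :
    (n + 1) * binomCoeff p (n + 1) = p * binomCoeff (p + 1) n := by
  rw [binomCoeff_eq, binomCoeff_eq, ascPochhammer_succ_left, Nat.factorial_succ]
  simp
  field_simp

/-! ### Power series dominated by a binomial series -/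

/-- The sum of the power series with coefficients `a`. -/
noncomputable def powerSum (a : ℕ → ℂ) (x : ℝ) : ℂ := ∑' n, a n * (x : ℂ) ^ n

/-- The coefficients of the derivative of a power series. -/
def derivCoeff (a : ℕ → ℂ) (n : ℕ) : ℂ := (n + 1) * a (n + 1)

/-- Differentiating `(1 - x)^(-p)` raises `p` by one, so the class of series with a binomial
majorant is closed under differentiation. -/
theorem norm_derivCoeff_le {a : ℕ → ℂ} {C p : ℝ} (ha : ∀ n, ‖a n‖ ≤ C * binomCoeff p n) (n : ℕ) :
    ‖derivCoeff a n‖ ≤ C * p * binomCoeff (p + 1) n := by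
  have h : ‖((n : ℂ) + 1)‖ = n + 1 := by
    rw [← Nat.cast_succ, Complex.norm_natCast]; simp
  rw [derivCoeff, norm_mul, h, mul_assoc, ← binomCoeff_succ', mul_left_comm]
  exact mul_le_mul_of_nonneg_left (ha _) (by positivity)

theorem summable_powerSum {a : ℕ → ℂ} {C p : ℝ} (ha : ∀ n, ‖a n‖ ≤ C * binomCoeff p n) {x : ℝ}
    (hx : |x| < 1) : Summable fun n => a n * (x : ℂ) ^ n := by
  refine Summable.of_norm_bounded
    (((hasSum_binomCoeff p (x := |x|) (by simpa using hx)).mul_left C).summable) fun n => ?_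
  rw [norm_mul, norm_pow, Complex.norm_real, Real.norm_eq_abs, ← mul_assoc]
  exact mul_le_mul_of_nonneg_right (ha n) (by positivity)

theorem norm_powerSum_le {a : ℕ → ℂ} {C p : ℝ} (ha : ∀ n, ‖a n‖ ≤ C * binomCoeff p n) {x : ℝ}
    (hx0 : 0 ≤ x) (hx1 : x < 1) : ‖powerSum a x‖ ≤ C * (1 - x) ^ (-p) := by
  refine tsum_of_norm_bounded
    ((hasSum_binomCoeff p (x := x) (by rwa [abs_of_nonneg hx0])).mul_left C) fun n => ?_
  rw [norm_mul, norm_pow, Complex.norm_real, Real.norm_eq_abs, ← mul_assoc, abs_of_nonneg hx0]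
  exact mul_le_mul_of_nonneg_right (ha n) (by positivity)

/-- Termwise differentiation on `(-r, r)` with `|x| < r < 1`: the differentiated terms are dominated
by their absolute values at `r`. -/
theorem hasDerivAt_powerSum {a : ℕ → ℂ} {C p : ℝ} (ha : ∀ n, ‖a n‖ ≤ C * binomCoeff p n) {x : ℝ}
    (hx : |x| < 1) : HasDerivAt (powerSum a) (powerSum (derivCoeff a) x) x := by
  obtain ⟨r, hxr, hr1⟩ := exists_between hx
  have hr0 : 0 ≤ r := (abs_nonneg x).trans hxr.le
  have hs : Summable fun n => ‖derivCoeff a n * (r : ℂ) ^ n‖ :=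
    (summable_powerSum (norm_derivCoeff_le ha) (by rwa [abs_of_nonneg hr0])).norm
  have hs' : Summable fun n : ℕ => ‖a n * n * (r : ℂ) ^ (n - 1)‖ := by
    -- The truncated exponent `n - 1` at `n = 0` is harmless because of the factor `n`; the shift
    -- removes that term.
    rw [← summable_nat_add_iff 1]
    refine hs.congr fun n => ?_
    simp [derivCoeff, mul_comm]
  have key : HasDerivAt (fun z : ℝ => ∑' n, a n * (z : ℂ) ^ n)
      (∑' n : ℕ, a n * (n * (x : ℂ) ^ (n - 1))) x := by
    refine hasDerivAt_tsum_of_isPreconnected (g := fun n (z : ℝ) => a n * (z : ℂ) ^ n)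
      (g' := fun n z => a n * (n * (z : ℂ) ^ (n - 1))) (t := Ioo (-r) r) (y₀ := 0) hs' isOpen_Ioo
      isPreconnected_Ioo (fun n y _ => ?_) (fun n y hy => ?_) ?_ ?_ ?_
    · have h : HasDerivAt (fun z : ℝ => (z : ℂ)) 1 y := by
        simpa using (hasDerivAt_id y).ofReal_comp
      simpa using (h.pow n).const_mul (a n)
    · rw [← mul_assoc, norm_mul, norm_mul _ ((r : ℂ) ^ _), norm_pow, norm_pow, Complex.norm_real,
        Complex.norm_real, Real.norm_eq_abs, Real.norm_eq_abs, abs_of_nonneg hr0]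
      exact mul_le_mul_of_nonneg_left (pow_le_pow_left₀ (abs_nonneg y) (abs_lt.2 hy).le _)
        (norm_nonneg _)
    · exact ⟨by linarith [abs_nonneg x], by linarith [abs_nonneg x]⟩
    · exact summable_powerSum ha (by simp)
    · exact abs_lt.1 hxr
  have hsx : Summable fun n : ℕ => a n * (n * (x : ℂ) ^ (n - 1)) := by
    rw [← summable_nat_add_iff 1]
    refine (summable_powerSum (norm_derivCoeff_le ha) hx).congr fun n => ?_
    simp [derivCoeff]; ring
  rw [hsx.tsum_eq_zero_add] at key
  convert! key using 1
  simp only [powerSum, derivCoeff]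
  simp
  refine tsum_congr fun n => ?_
  ring

/-! ### The hypergeometric series in the definition of the Legendre function -/

/-- The coefficients of `₂F₁(-ν, -ν; 1; x)`. -/
noncomputable def hypCoeff (ν : ℂ) (n : ℕ) : ℂ :=
  ((ascPochhammer ℂ n).eval (-ν) / n.factorial) ^ 2

theorem ordinaryHypergeometric_eq_powerSum (ν : ℂ) (x : ℝ) :
    ordinaryHypergeometric (-ν) (-ν) (1 : ℂ) (x : ℂ) = powerSum (hypCoeff ν) x := by
  rw [ordinaryHypergeometric_eq_tsum, powerSum]
  refine tsum_congr fun n => ?_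
  rw [ascPochhammer_eval_one, hypCoeff, smul_eq_mul]
  field_simp

theorem hypCoeff_succ (ν : ℂ) (n : ℕ) :
    (n + 1 : ℂ) ^ 2 * hypCoeff ν (n + 1) = (n - ν) ^ 2 * hypCoeff ν n := by
  have h : (n + 1 : ℂ) ≠ 0 := Nat.cast_add_one_ne_zero n
  rw [hypCoeff, hypCoeff, ascPochhammer_succ_eval, Nat.factorial_succ]
  push_cast
  field_simp
  ring

/-- Successive coefficients have ratio of modulus `1 - (2 + 2 Re ν)/n + O(1/n²)`, those of the
binomial series `1 + (p - 1)/n + O(1/n²)`. The second is eventually larger exactly when `p > -1 - 2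
Re ν`, up to the borderline case. -/
theorem exists_norm_hypCoeff_le (ν : ℂ) {p : ℝ} (hp : 0 < p) (hp' : -1 - 2 * ν.re < p) :
    ∃ C, 0 ≤ C ∧ ∀ n, ‖hypCoeff ν n‖ ≤ C * binomCoeff p n := by
  -- From this `N` on, `|n - ν|² ≤ (n + 1)(p + n)`, which is the comparison of the two ratios.
  obtain ⟨N, hN⟩ := exists_nat_gt (‖ν‖ ^ 2 / (p + 1 + 2 * ν.re))
  have hd : 0 < p + 1 + 2 * ν.re := by linarith
  rw [div_lt_iff₀ hd] at hN
  have hstep : ∀ n, N ≤ n → ∀ C, 0 ≤ C → ‖hypCoeff ν n‖ ≤ C * binomCoeff p n →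
      ‖hypCoeff ν (n + 1)‖ ≤ C * binomCoeff p (n + 1) := by
    intro n hn C hC h
    have h1 := congrArg norm (hypCoeff_succ ν n)
    have h2 := binomCoeff_succ p n
    have hnc : (N : ℝ) ≤ n := by exact_mod_cast hn
    have h3 : ‖((n : ℂ) + 1)‖ = n + 1 := by
      rw [← Nat.cast_succ, Complex.norm_natCast]; simp
    have h4 : ‖((n : ℂ) - ν)‖ ^ 2 = n ^ 2 - 2 * n * ν.re + ‖ν‖ ^ 2 := by
      rw [Complex.sq_norm, Complex.sq_norm, Complex.normSq_apply, Complex.normSq_apply]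
      simp; ring
    rw [norm_mul, norm_mul, norm_pow, norm_pow, h3, h4] at h1
    have hn1 : (0 : ℝ) < n + 1 := by positivity
    have h5 : (n : ℝ) ^ 2 - 2 * n * ν.re + ‖ν‖ ^ 2 ≤ (n + 1) * (p + n) := by nlinarith
    have h6 : ((n : ℝ) + 1) ^ 2 * ‖hypCoeff ν (n + 1)‖ ≤
        (n + 1) ^ 2 * (C * binomCoeff p (n + 1)) := by
      rw [h1]
      calc _ ≤ (n + 1) * (p + n) * (C * binomCoeff p n) :=
            mul_le_mul h5 h (norm_nonneg _) (by positivity)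
        _ = (n + 1) * C * ((p + n) * binomCoeff p n) := by ring
        _ = _ := by rw [← h2]; ring
    exact le_of_mul_le_mul_left h6 (by positivity)
  -- The sum bounds each of the finitely many initial quotients; after `N` the same constant
  -- propagates by `hstep`.
  set C := ∑ n ∈ Finset.range (N + 1), ‖hypCoeff ν n‖ / binomCoeff p n with hC
  have hpos : ∀ n ∈ Finset.range (N + 1), 0 ≤ ‖hypCoeff ν n‖ / binomCoeff p n :=
    fun n _ => div_nonneg (norm_nonneg _) (binomCoeff_pos hp n).le
  have hC0 : 0 ≤ C := Finset.sum_nonneg hpos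
  have hsmall : ∀ n ≤ N, ‖hypCoeff ν n‖ ≤ C * binomCoeff p n := fun n hn => by
    rw [← div_le_iff₀ (binomCoeff_pos hp n)]
    exact Finset.single_le_sum hpos (Finset.mem_range.2 (by omega))
  refine ⟨C, hC0, fun n => ?_⟩
  rcases le_total n N with hn | hn
  · exact hsmall n hn
  · induction n, hn using Nat.le_induction with
    | base => exact hsmall N le_rfl
    | succ n hn ih => exact hstep n hn C hC0 ih

/-- Multiplication by `x` undoes the index shift of differentiation, so `F`, `x F'` and the other
terms of the equation can be compared at the same power. -/
theorem hasSum_mul_coeff {a : ℕ → ℂ} {x : ℝ} {S : ℂ}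
    (h : HasSum (fun n => derivCoeff a n * (x : ℂ) ^ n) S) :
    HasSum (fun n : ℕ => n * a n * (x : ℂ) ^ n) (x * S) := by
  rw [← hasSum_nat_add_iff' 1]
  simp only [Finset.range_one, Finset.sum_singleton, Nat.cast_zero, zero_mul, sub_zero]
  convert! h.mul_left (x : ℂ) using 2 with n
  rw [derivCoeff]; push_cast; ring

/-- The hypergeometric equation for `₂F₁(-ν, -ν; 1; x)`. -/
theorem hypergeometric_ode (ν : ℂ) {x : ℝ} (hx : |x| < 1) :
    x * (1 - x) * powerSum (derivCoeff (derivCoeff (hypCoeff ν))) x +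
      (1 - (1 - 2 * ν) * x) * powerSum (derivCoeff (hypCoeff ν)) x -
        ν ^ 2 * powerSum (hypCoeff ν) x = 0 := by
  obtain ⟨C, -, hC⟩ := exists_norm_hypCoeff_le ν (p := |(-1 - 2 * ν.re)| + 1) (by positivity)
    (by linarith [le_abs_self (-1 - 2 * ν.re)])
  have h0 := (summable_powerSum hC hx).hasSum
  have h1 := (summable_powerSum (norm_derivCoeff_le hC) hx).hasSum
  have h2 := (summable_powerSum (norm_derivCoeff_le (norm_derivCoeff_le hC)) hx).hasSum
  have h3 := hasSum_mul_coeff h1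
  have h4 := hasSum_mul_coeff h2
  -- For the coefficients `(n - 1) a n` the derivative series is that of `x F''`, so the lemma now
  -- gives `x² F''`.
  have h5 := hasSum_mul_coeff (a := fun n => (n - 1) * hypCoeff ν n)
    (h4.congr_fun (g := fun n => derivCoeff (fun n => (n - 1) * hypCoeff ν n) n * (x : ℂ) ^ n)
      fun n => by simp only [derivCoeff]; push_cast; ring)
  have h := (((h4.sub h5).add h1).sub (h3.mul_left (1 - 2 * ν))).sub (h0.mul_left (ν ^ 2))
  have hz := h.unique (hasSum_zero.congr_fun fun n => ?_)
  · rw [← hz]; simp only [powerSum]; ring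
  · have := hypCoeff_succ ν n
    simp only [derivCoeff]
    linear_combination (x : ℂ) ^ n * this

/-! ### The Legendre function: derivative, differential equation, growth -/

theorem legendreP_eq (ν : ℂ) (z : ℝ) :
    legendreP ν z = (((1 + z) / 2 : ℝ) : ℂ) ^ ν * powerSum (hypCoeff ν) ((z - 1) / (z + 1)) := by
  rw [legendreP, ordinaryHypergeometric_eq_powerSum]

theorem legendreP_one (ν : ℂ) : legendreP ν 1 = 1 := by
  simp [legendreP, ordinaryHypergeometric_zero]

theorem abs_legendre_arg_lt {z : ℝ} (hz : 0 < z) : |(z - 1) / (z + 1)| < 1 := by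
  rw [abs_lt, lt_div_iff₀ (by linarith), div_lt_iff₀ (by linarith)]
  constructor <;> linarith

theorem hasDerivAt_legendre_arg {z : ℝ} (hz : 0 < z) :
    HasDerivAt (fun z : ℝ => (z - 1) / (z + 1)) (2 / (z + 1) ^ 2) z := by
  convert! ((hasDerivAt_id z).sub_const 1).div ((hasDerivAt_id z).add_const 1)
    (show z + 1 ≠ 0 by linarith) using 1
  simp only [id]; congr 1; ring

theorem hasDerivAt_powerSum_arg {a : ℕ → ℂ} {C p : ℝ} (ha : ∀ n, ‖a n‖ ≤ C * binomCoeff p n)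
    {z : ℝ} (hz : 0 < z) :
    HasDerivAt (fun z : ℝ => powerSum a ((z - 1) / (z + 1)))
      (2 / (z + 1) ^ 2 * powerSum (derivCoeff a) ((z - 1) / (z + 1))) z := by
  convert! (hasDerivAt_powerSum ha (abs_legendre_arg_lt hz)).scomp z (hasDerivAt_legendre_arg hz)
    using 1
  rw [Complex.real_smul]; push_cast; rfl

theorem hasDerivAt_cpow_half {z : ℝ} (hz : 0 < z) (a : ℂ) :
    HasDerivAt (fun z : ℝ => (((1 + z) / 2 : ℝ) : ℂ) ^ a)
      (a / 2 * (((1 + z) / 2 : ℝ) : ℂ) ^ (a - 1)) z := by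
  have h : HasDerivAt (fun z : ℝ => (((1 + z) / 2 : ℝ) : ℂ)) (((1 / 2 : ℝ)) : ℂ) z :=
    (((hasDerivAt_id z).const_add 1).div_const 2).ofReal_comp
  have hs : (((1 + z) / 2 : ℝ) : ℂ) ∈ Complex.slitPlane :=
    Complex.ofReal_mem_slitPlane.2 (by linarith)
  convert! ((hasDerivAt_id (((1 + z) / 2 : ℝ) : ℂ)).cpow_const (c := a) hs).scomp z h using 1
  rw [smul_eq_mul, id_eq]
  push_cast; ring

/-- The formula for the derivative of the Legendre function. -/
noncomputable def legendreDeriv (ν : ℂ) (z : ℝ) : ℂ :=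
  (((1 + z) / 2 : ℝ) : ℂ) ^ (ν - 1) / 2 * (ν * powerSum (hypCoeff ν) ((z - 1) / (z + 1)) +
    2 / (z + 1) * powerSum (derivCoeff (hypCoeff ν)) ((z - 1) / (z + 1)))

theorem hasDerivAt_legendreP (ν : ℂ) {z : ℝ} (hz : 0 < z) :
    HasDerivAt (legendreP ν) (legendreDeriv ν z) z := by
  obtain ⟨C, -, hC⟩ := exists_norm_hypCoeff_le ν (p := |(-1 - 2 * ν.re)| + 1) (by positivity)
    (by linarith [le_abs_self (-1 - 2 * ν.re)])
  rw [funext (legendreP_eq ν)]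
  have hz1 : ((z : ℂ) + 1) ≠ 0 := by exact_mod_cast (by linarith : z + 1 ≠ 0)
  have hc : (((1 + z) / 2 : ℝ) : ℂ) ≠ 0 := by exact_mod_cast (by linarith : (1 + z) / 2 ≠ 0)
  convert! (hasDerivAt_cpow_half hz ν).mul (hasDerivAt_powerSum_arg hC hz) using 1
  rw [legendreDeriv, Complex.cpow_sub _ _ hc, Complex.cpow_one]
  push_cast
  rw [add_comm (1 : ℂ)]
  field_simp

theorem deriv_legendreP (ν : ℂ) {z : ℝ} (hz : 0 < z) :
    deriv (legendreP ν) z = legendreDeriv ν z := (hasDerivAt_legendreP ν hz).deriv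

/-- Legendre's equation `((1 - z²) P')' = -ν (ν + 1) P`. -/
theorem legendre_ode (ν : ℂ) {z : ℝ} (hz : 0 < z) :
    HasDerivAt (fun z : ℝ => (1 - (z : ℂ) ^ 2) * legendreDeriv ν z)
      (-(ν * (ν + 1)) * legendreP ν z) z := by
  obtain ⟨C, -, hC⟩ := exists_norm_hypCoeff_le ν (p := |(-1 - 2 * ν.re)| + 1) (by positivity)
    (by linarith [le_abs_self (-1 - 2 * ν.re)])
  have hz1 : ((z : ℂ) + 1) ≠ 0 := by exact_mod_cast (by linarith : z + 1 ≠ 0)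
  have hc : (((1 + z) / 2 : ℝ) : ℂ) ≠ 0 := by exact_mod_cast (by linarith : (1 + z) / 2 ≠ 0)
  have hid : HasDerivAt (fun z : ℝ => (z : ℂ)) 1 z := by
    simpa using (hasDerivAt_id z).ofReal_comp
  have h1 : HasDerivAt (fun z : ℝ => (2 : ℂ) / (z + 1)) (-2 / (z + 1) ^ 2) z := by
    convert! (hasDerivAt_const z (2 : ℂ)).div (hid.add_const 1) hz1 using 1
    simp
  have h2 := (((hasDerivAt_powerSum_arg hC hz).const_mul ν).add
    (h1.mul (hasDerivAt_powerSum_arg (norm_derivCoeff_le hC) hz)))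
  have h3 := ((hasDerivAt_const z (1 : ℂ)).sub (hid.pow 2)).mul
    (((hasDerivAt_cpow_half hz (ν - 1)).div_const 2).mul h2)
  have ode := hypergeometric_ode ν (abs_legendre_arg_lt hz)
  rw [legendreP_eq]
  convert! h3 using 1
  simp only [Pi.add_apply, Pi.mul_apply, Pi.sub_apply, Pi.pow_apply]
  -- With `F`, `F'`, `F''` at `(z - 1)/(z + 1)` as atoms and all powers reduced to `((1 + z)/2)^ν`,
  -- the claim becomes a multiple of the hypergeometric equation.
  generalize powerSum (derivCoeff (derivCoeff (hypCoeff ν))) ((z - 1) / (z + 1)) = F2 at *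
  generalize powerSum (derivCoeff (hypCoeff ν)) ((z - 1) / (z + 1)) = F1 at *
  generalize powerSum (hypCoeff ν) ((z - 1) / (z + 1)) = F0 at *
  have e1 : (((1 + z) / 2 : ℝ) : ℂ) ^ (ν - 1) =
      (((1 + z) / 2 : ℝ) : ℂ) ^ ν / (((1 + z) / 2 : ℝ) : ℂ) := by
    rw [Complex.cpow_sub _ _ hc, Complex.cpow_one]
  have e2 : (((1 + z) / 2 : ℝ) : ℂ) ^ (ν - 1 - 1) =
      (((1 + z) / 2 : ℝ) : ℂ) ^ ν / (((1 + z) / 2 : ℝ) : ℂ) / (((1 + z) / 2 : ℝ) : ℂ) := by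
    rw [Complex.cpow_sub _ _ hc, e1, Complex.cpow_one]
  rw [e1, e2]
  generalize (((1 + z) / 2 : ℝ) : ℂ) ^ ν = E
  push_cast at ode hc ⊢
  rw [add_comm (1 : ℂ)]
  field_simp at ode ⊢
  linear_combination 2 * E * (z + 1) * ode

theorem continuousOn_legendreP (ν : ℂ) : ContinuousOn (legendreP ν) (Ioi 0) :=
  fun _ hz => (hasDerivAt_legendreP ν hz).continuousAt.continuousWithinAt

theorem continuousOn_legendreDeriv (ν : ℂ) : ContinuousOn (legendreDeriv ν) (Ioi 0) := by
  obtain ⟨C, -, hC⟩ := exists_norm_hypCoeff_le ν (p := |(-1 - 2 * ν.re)| + 1) (by positivity)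
    (by linarith [le_abs_self (-1 - 2 * ν.re)])
  intro z hz
  have hz' : (0 : ℝ) < z := hz
  have hz1 : ((z : ℂ) + 1) ≠ 0 := by exact_mod_cast (by linarith : z + 1 ≠ 0)
  have h0 := (hasDerivAt_powerSum_arg hC hz).continuousAt
  have h1 := (hasDerivAt_powerSum_arg (norm_derivCoeff_le hC) hz).continuousAt
  have h2 := (hasDerivAt_cpow_half hz (ν - 1)).continuousAt
  have h3 : ContinuousAt (fun z : ℝ => (2 : ℂ) / (z + 1)) z :=
    continuousAt_const.div (by fun_prop) hz1
  exact ((h2.div_const 2).mul ((continuousAt_const.mul h0).add (h3.mul h1))).continuousWithinAt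

/-- Growth of the Legendre function at infinity. -/
theorem exists_norm_legendre_le (ν : ℂ) {r : ℝ} (h1 : ν.re < r) (h2 : -1 - ν.re < r) :
    ∃ C, ∀ z : ℝ, 1 ≤ z → ‖legendreP ν z‖ ≤ C * z ^ r ∧ ‖legendreDeriv ν z‖ ≤ C * z ^ (r - 1) := by
  -- With `w = (z - 1)/(z + 1)` one has `1 - w = ((1 + z)/2)⁻¹`, so this `p` turns the prefactor
  -- times the majorant into `((1 + z)/2)^r`. The two hypotheses on `r` are the two conditions on
  -- `p`.
  obtain ⟨C, hC0, hC⟩ := exists_norm_hypCoeff_le ν (p := r - ν.re) (by linarith) (by linarith)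
  -- Since `z/2 ≤ (1 + z)/2 ≤ z`, powers of `(1 + z)/2` may be replaced by powers of `z`; the sign
  -- of `a` decides which inequality is used.
  have hc : ∀ a : ℝ, ∃ K, 0 ≤ K ∧ ∀ z : ℝ, 1 ≤ z → ((1 + z) / 2) ^ a ≤ K * z ^ a := by
    intro a
    refine ⟨max 1 ((1 / 2) ^ a), by positivity, fun z hz => ?_⟩
    rcases le_total 0 a with ha | ha
    · calc ((1 + z) / 2) ^ a ≤ z ^ a :=
            Real.rpow_le_rpow (by linarith) (by linarith) ha
        _ ≤ _ := le_mul_of_one_le_left (by positivity) (le_max_left _ _)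
    · calc ((1 + z) / 2) ^ a ≤ (1 / 2 * z) ^ a :=
            Real.rpow_le_rpow_of_nonpos (by linarith) (by linarith) ha
        _ = (1 / 2) ^ a * z ^ a := Real.mul_rpow (by norm_num) (by linarith)
        _ ≤ _ := mul_le_mul_of_nonneg_right (le_max_right _ _) (by positivity)
  obtain ⟨K0, hK0, h0⟩ := hc r
  obtain ⟨K1, hK1, h1'⟩ := hc (r - 1)
  have hp : 0 ≤ r - ν.re := by linarith
  refine ⟨max (C * K0) ((‖ν‖ * C + C * (r - ν.re)) / 2 * K1), fun z hz => ?_⟩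
  have hz0 : 0 < z := by linarith
  have hc0 : 0 < (1 + z) / 2 := by linarith
  have hw0 : 0 ≤ (z - 1) / (z + 1) := div_nonneg (by linarith) (by linarith)
  have hw1 : (z - 1) / (z + 1) < 1 := (abs_lt.1 (abs_legendre_arg_lt hz0)).2
  have hw2 : 1 - (z - 1) / (z + 1) = ((1 + z) / 2)⁻¹ := by field_simp; ring
  have b0 := norm_powerSum_le hC hw0 hw1
  have b1 := norm_powerSum_le (norm_derivCoeff_le hC) hw0 hw1
  rw [hw2, Real.inv_rpow hc0.le, ← Real.rpow_neg hc0.le, neg_neg] at b0 b1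
  constructor
  · rw [legendreP_eq, norm_mul, Complex.norm_cpow_eq_rpow_re_of_pos hc0]
    calc _ ≤ ((1 + z) / 2) ^ ν.re * (C * ((1 + z) / 2) ^ (r - ν.re)) := by gcongr
      _ = C * ((1 + z) / 2) ^ r := by
        rw [mul_left_comm, ← Real.rpow_add hc0]; ring_nf
      _ ≤ C * (K0 * z ^ r) := by gcongr; exact h0 z hz
      _ ≤ _ := by rw [← mul_assoc]; gcongr; exact le_max_left _ _
  · have hd : ‖(2 : ℂ) / (z + 1)‖ = ((1 + z) / 2)⁻¹ := by
      rw [norm_div, ← Complex.ofReal_one, ← Complex.ofReal_add, Complex.norm_real,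
        Real.norm_of_nonneg (by linarith), Complex.norm_ofNat]
      field_simp; ring
    rw [legendreDeriv, norm_mul, norm_div, Complex.norm_cpow_eq_rpow_re_of_pos hc0,
      Complex.norm_ofNat, Complex.sub_re, Complex.one_re]
    -- The majorant of `F'` has one power of `(1 + z)/2` more, which the factor `2/(z + 1)` takes
    -- back.
    calc _ ≤ ((1 + z) / 2) ^ (ν.re - 1) / 2 * (‖ν‖ * (C * ((1 + z) / 2) ^ (r - ν.re)) +
          ((1 + z) / 2)⁻¹ * (C * (r - ν.re) * ((1 + z) / 2) ^ (r - ν.re + 1))) := by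
          refine mul_le_mul_of_nonneg_left ((norm_add_le _ _).trans ?_) (by positivity)
          rw [norm_mul, norm_mul, hd]
          gcongr
      _ = (‖ν‖ * C + C * (r - ν.re)) / 2 * ((1 + z) / 2) ^ (r - 1) := by
        rw [Real.rpow_add hc0, Real.rpow_one,
          show r - 1 = (ν.re - 1) + (r - ν.re) by ring, Real.rpow_add hc0]
        field_simp
      _ ≤ (‖ν‖ * C + C * (r - ν.re)) / 2 * (K1 * z ^ (r - 1)) := by
        gcongr; exact h1' z hz
      _ ≤ _ := by rw [← mul_assoc]; gcongr; exact le_max_right _ _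

/-- The Legendre function and its derivative are bounded on `(0, 1]`. -/
theorem exists_norm_legendre_le_of_le_one (ν : ℂ) :
    ∃ C, ∀ z : ℝ, 0 < z → z ≤ 1 → ‖legendreP ν z‖ ≤ C ∧ ‖legendreDeriv ν z‖ ≤ C := by
  -- As `z → 0` the hypergeometric argument tends to `-1`, where the majorant gives no uniform
  -- bound. But `(P, (1 - z²) P')` solves a linear system that is regular at `0`; it is followed
  -- from `z = 1/2` towards `0`, in the time `t = 1/2 - z`.
  set Y : ℝ → ℂ × ℂ := fun t =>
    (legendreP ν (1 / 2 - t), (1 - ((1 / 2 - t : ℝ) : ℂ) ^ 2) * legendreDeriv ν (1 / 2 - t)) with hY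
  set Y' : ℝ → ℂ × ℂ := fun t =>
    (-legendreDeriv ν (1 / 2 - t), ν * (ν + 1) * legendreP ν (1 / 2 - t)) with hY'
  -- The `2` bounds `1/(1 - z²)` on `(0, 1/2]`, the other term comes from Legendre's equation; their
  -- sum exceeds both components in the sup norm.
  set K : ℝ := 2 + ‖ν * (ν + 1)‖ with hK
  have hq : ∀ z : ℝ, 0 < z → z ≤ 1 / 2 →
      ‖legendreDeriv ν z‖ ≤ 2 * ‖(1 - (z : ℂ) ^ 2) * legendreDeriv ν z‖ := by
    intro z h0 h1
    have : ‖(1 - (z : ℂ) ^ 2)‖ = 1 - z ^ 2 := by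
      rw [← Complex.ofReal_one, ← Complex.ofReal_pow, ← Complex.ofReal_sub, Complex.norm_real,
        Real.norm_of_nonneg (by nlinarith)]
    rw [norm_mul, this]
    have h2 : 0 ≤ 1 - 2 * z ^ 2 := by nlinarith
    nlinarith [mul_nonneg h2 (norm_nonneg (legendreDeriv ν z))]
  have hder : ∀ t : ℝ, t < 1 / 2 → HasDerivAt Y (Y' t) t := by
    intro t ht
    have hz : 0 < 1 / 2 - t := by linarith
    have hs : HasDerivAt (fun t : ℝ => 1 / 2 - t) (-1) t := (hasDerivAt_id t).const_sub _
    refine HasDerivAt.prodMk ?_ ?_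
    · convert! (hasDerivAt_legendreP ν hz).scomp t hs using 1
      simp
    · convert! (legendre_ode ν hz).scomp t hs using 1
      simp
  have hbound : ∀ z : ℝ, 0 < z → z ≤ 1 / 2 → ‖Y (1 / 2 - z)‖ ≤ ‖Y 0‖ * Real.exp K := by
    intro z h0 h1
    have h := norm_le_gronwallBound_of_norm_deriv_right_le (f := Y) (f' := Y') (δ := ‖Y 0‖)
      (K := K) (ε := 0) (a := 0) (b := 1 / 2 - z)
      (fun t ht => (hder t (by linarith [ht.2])).continuousAt.continuousWithinAt)
      (fun t ht => (hder t (by linarith [ht.2])).hasDerivWithinAt) le_rfl ?_ (1 / 2 - z)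
      ⟨by linarith, le_rfl⟩
    · rw [gronwallBound_ε0] at h
      refine h.trans (mul_le_mul_of_nonneg_left (Real.exp_le_exp.2 ?_) (norm_nonneg _))
      have : 0 ≤ K := by positivity
      nlinarith
    · intro t ht
      have hz : 0 < 1 / 2 - t := by linarith [ht.2]
      have := hq _ hz (by linarith [ht.1])
      have n1 : ‖legendreP ν (1 / 2 - t)‖ ≤ ‖Y t‖ := norm_fst_le (Y t)
      have n2 := norm_snd_le (Y t)
      rw [add_zero, Prod.norm_def]
      refine max_le ?_ ?_
      · simp only [hY', norm_neg]
        have : 0 ≤ ‖ν * (ν + 1)‖ * ‖Y t‖ := by positivity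
        rw [hK]; linarith
      · simp only [hY', norm_mul _ (legendreP ν _)]
        have := mul_le_mul_of_nonneg_left n1 (norm_nonneg (ν * (ν + 1)))
        rw [hK]; linarith [norm_nonneg (Y t)]
  obtain ⟨B, hB⟩ : ∃ B, ∀ z : ℝ, 0 < z → z ≤ 1 / 2 → ‖Y (1 / 2 - z)‖ ≤ B := ⟨_, hbound⟩
  have hsub : Icc (1 / 2 : ℝ) 1 ⊆ Ioi 0 := fun z hz => by
    have := hz.1; simp only [mem_Ioi]; linarith
  obtain ⟨C1, hC1⟩ := isCompact_Icc.exists_bound_of_continuousOn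
    ((continuousOn_legendreP ν).mono hsub)
  obtain ⟨C2, hC2⟩ := isCompact_Icc.exists_bound_of_continuousOn
    ((continuousOn_legendreDeriv ν).mono hsub)
  refine ⟨max (max C1 C2) (2 * B), fun z h0 h1 => ?_⟩
  rcases le_total z (1 / 2) with h | h
  · have hb := hB z h0 h
    have n1 := norm_fst_le (Y (1 / 2 - z))
    have n2 := norm_snd_le (Y (1 / 2 - z))
    simp only [hY, sub_sub_cancel] at n1 n2
    have := hq z h0 h
    simp only [hY, sub_sub_cancel] at hb
    refine ⟨le_max_of_le_right ?_, le_max_of_le_right ?_⟩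
    · have := norm_nonneg (legendreP ν z); linarith
    · linarith
  · exact ⟨le_max_of_le_left (le_max_of_le_left (hC1 z ⟨h, h1⟩)),
      le_max_of_le_left (le_max_of_le_right (hC2 z ⟨h, h1⟩))⟩

/-! ### Mellin convolutions -/

/-- Mellin convergence only gives measurability of `t^(s-1) f(t)`; the power is divided out. -/
theorem aestronglyMeasurable_of_mellinConvergent {f : ℝ → ℂ} {s : ℂ} (hf : MellinConvergent f s) :
    AEStronglyMeasurable f (volume.restrict (Ioi 0)) := by
  have h1 : AEStronglyMeasurable (fun t : ℝ => (t : ℂ) ^ (1 - s)) (volume.restrict (Ioi 0)) := by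
    refine ContinuousOn.aestronglyMeasurable (fun t ht => ?_) measurableSet_Ioi
    exact (Complex.continuousAt_ofReal_cpow_const t _ (Or.inr (ne_of_gt ht))).continuousWithinAt
  refine (h1.mul hf.aestronglyMeasurable).congr ?_
  filter_upwards [ae_restrict_mem measurableSet_Ioi] with t ht
  have ht' : (t : ℂ) ≠ 0 := by exact_mod_cast (ne_of_gt ht)
  simp only [Pi.mul_apply, smul_eq_mul]
  rw [← mul_assoc, ← Complex.cpow_add _ _ ht']
  simp

theorem norm_cpow_sub_one {t : ℝ} (ht : 0 < t) (s : ℂ) :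
    ‖(t : ℂ) ^ (s - 1)‖ = t ^ (s.re - 1) := by
  rw [Complex.norm_cpow_eq_rpow_re_of_pos ht]; simp

theorem measurable_mellinConv_kernel {k : ℝ → ℂ} (hk : Measurable k) :
    Measurable fun p : ℝ × ℝ => k (p.1 / p.2) := hk.comp (measurable_fst.div measurable_snd)

/-- A pointwise bound on the kernel, and not merely its integrability, makes the convolution
converge for every `x` instead of almost every `x`. -/
theorem norm_mellinConv_integrand_le {k f : ℝ → ℂ} {C σ : ℝ}
    (hkC : ∀ u : ℝ, 0 < u → ‖k u‖ ≤ C * u ^ (-σ)) {x y : ℝ} (hx : 0 < x) (hy : 0 < y) :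
    ‖k (x / y) * f y / (y : ℂ)‖ ≤ C * x ^ (-σ) * (y ^ (σ - 1) * ‖f y‖) := by
  rw [norm_div, norm_mul, Complex.norm_real, Real.norm_of_nonneg hy.le]
  calc _ ≤ C * (x / y) ^ (-σ) * ‖f y‖ / y := by gcongr; exact hkC _ (div_pos hx hy)
    _ = _ := by
      rw [Real.div_rpow hx.le hy.le, Real.rpow_neg hy.le, Real.rpow_sub hy, Real.rpow_one]
      field_simp

theorem integrableOn_rpow_mul_norm {f : ℝ → ℂ} {s : ℂ} (hf : MellinConvergent f s) :
    IntegrableOn (fun y : ℝ => y ^ (s.re - 1) * ‖f y‖) (Ioi 0) := by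
  refine hf.norm.congr ?_
  filter_upwards [ae_restrict_mem measurableSet_Ioi] with y hy
  rw [norm_smul, norm_cpow_sub_one hy]

theorem integrableOn_mellinConv {k f : ℝ → ℂ} {C : ℝ} {s : ℂ} (hk : Measurable k)
    (hkC : ∀ u : ℝ, 0 < u → ‖k u‖ ≤ C * u ^ (-s.re)) (hf : MellinConvergent f s) {x : ℝ}
    (hx : 0 < x) : IntegrableOn (fun y : ℝ => k (x / y) * f y / (y : ℂ)) (Ioi 0) := by
  refine ((integrableOn_rpow_mul_norm hf).const_mul (C * x ^ (-s.re))).mono' ?_ ?_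
  · have h1 : Measurable fun y : ℝ => k (x / y) := hk.comp (measurable_const.div measurable_id)
    have h2 : Measurable fun y : ℝ => (y : ℂ)⁻¹ := by fun_prop
    simp only [div_eq_mul_inv]
    simp only [div_eq_mul_inv] at h1
    exact (h1.aestronglyMeasurable.mul (aestronglyMeasurable_of_mellinConvergent hf)).mul
      h2.aestronglyMeasurable
  · filter_upwards [ae_restrict_mem measurableSet_Ioi] with y hy
    exact norm_mellinConv_integrand_le hkC hx hy

theorem aestronglyMeasurable_mellinConv_integrand {k f : ℝ → ℂ} {s : ℂ} (hk : Measurable k)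
    (hf : MellinConvergent f s) (μ : Measure ℝ) [SFinite μ] :
    AEStronglyMeasurable (fun p : ℝ × ℝ => k (p.1 / p.2) * f p.2 / (p.2 : ℂ))
      (μ.prod (volume.restrict (Ioi 0))) := by
  have h2 : Measurable fun p : ℝ × ℝ => (p.2 : ℂ)⁻¹ := by fun_prop
  simp only [div_eq_mul_inv _ ((_ : ℝ) : ℂ)]
  exact ((measurable_mellinConv_kernel hk).aestronglyMeasurable.mul
    (aestronglyMeasurable_of_mellinConvergent hf).comp_snd).mul h2.aestronglyMeasurable

theorem mellinConvergent_comp_div {k : ℝ → ℂ} {s : ℂ} (hks : MellinConvergent k s) {y : ℝ}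
    (hy : 0 < y) : MellinConvergent (fun x => k (x / y)) s := by
  simpa only [div_eq_inv_mul] using (MellinConvergent.comp_mul_left (inv_pos.2 hy)).2 hks

/-- Tonelli: the substitution `x = y u` makes the inner integral of the norm a constant times `y^(Re
s - 1) ‖f y‖`. -/
theorem integrable_mellinConv_prod {k f : ℝ → ℂ} {s : ℂ} (hk : Measurable k)
    (hks : MellinConvergent k s) (hf : MellinConvergent f s) :
    Integrable (fun p : ℝ × ℝ => (p.1 : ℂ) ^ (s - 1) * (k (p.1 / p.2) * f p.2 / (p.2 : ℂ)))
      ((volume.restrict (Ioi 0)).prod (volume.restrict (Ioi 0))) := by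
  have hm : Measurable fun p : ℝ × ℝ => (p.1 : ℂ) ^ (s - 1) := by fun_prop
  have ha := hm.aestronglyMeasurable.mul
    (aestronglyMeasurable_mellinConv_integrand hk hf (volume.restrict (Ioi 0)))
  refine (integrable_prod_iff' (by exact ha)).2 ⟨?_, ?_⟩
  · filter_upwards [ae_restrict_mem measurableSet_Ioi] with y hy
    refine ((mellinConvergent_comp_div hks hy).mul_const (f y / y)).congr (ae_of_all _ fun x => ?_)
    simp only [smul_eq_mul]; ring
  · refine ((integrableOn_rpow_mul_norm hf).const_mul
      (∫ u in Ioi (0 : ℝ), u ^ (s.re - 1) * ‖k u‖)).congr ?_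
    filter_upwards [ae_restrict_mem measurableSet_Ioi] with y hy
    have hy' : (0 : ℝ) < y := hy
    have h := integral_comp_mul_left_Ioi (fun u => u ^ (s.re - 1) * ‖k u‖) 0 (inv_pos.2 hy')
    rw [mul_zero, inv_inv, smul_eq_mul] at h
    have h2 : ∀ x ∈ Ioi (0 : ℝ), ‖(x : ℂ) ^ (s - 1) * (k (x / y) * f y / (y : ℂ))‖ =
        (y⁻¹ * x) ^ (s.re - 1) * ‖k (y⁻¹ * x)‖ * (y ^ (s.re - 1) * ‖f y‖ / y) := by
      intro x hx
      rw [norm_mul, norm_cpow_sub_one hx, norm_div, norm_mul, Complex.norm_real,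
        Real.norm_of_nonneg hy'.le, Real.mul_rpow (inv_pos.2 hy').le (le_of_lt hx),
        Real.inv_rpow hy'.le, div_eq_inv_mul x y]
      field_simp
    rw [setIntegral_congr_fun measurableSet_Ioi h2, integral_mul_const, h]
    field_simp

theorem mellinConvergent_mellinConv {k f : ℝ → ℂ} {s : ℂ} (hk : Measurable k)
    (hks : MellinConvergent k s) (hf : MellinConvergent f s) :
    MellinConvergent (mellinConv k f) s := by
  refine (integrable_mellinConv_prod hk hks hf).integral_prod_left.congr (ae_of_all _ fun x => ?_)
  simp only [smul_eq_mul, mellinConv, integral_const_mul]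

theorem mellin_mellinConv {k f : ℝ → ℂ} {s : ℂ} (hk : Measurable k)
    (hks : MellinConvergent k s) (hf : MellinConvergent f s) :
    mellin (mellinConv k f) s = mellin k s * mellin f s := by
  have h := integral_integral_swap (f := fun x y : ℝ =>
    (x : ℂ) ^ (s - 1) * (k (x / y) * f y / (y : ℂ))) (integrable_mellinConv_prod hk hks hf)
  simp only [integral_const_mul] at h
  simp only [mellin, mellinConv, smul_eq_mul]
  rw [h, ← integral_const_mul]
  refine setIntegral_congr_fun measurableSet_Ioi fun y hy => ?_
  have hy' : (0 : ℝ) < y := hy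
  have hyc : (y : ℂ) ≠ 0 := by exact_mod_cast hy'.ne'
  have h1 := mellin_comp_mul_left k s (inv_pos.2 hy')
  simp only [mellin, smul_eq_mul] at h1
  calc _ = (∫ x in Ioi (0 : ℝ), (x : ℂ) ^ (s - 1) * k (y⁻¹ * x)) * (f y / y) := by
        rw [← integral_mul_const]
        refine integral_congr_ae (ae_of_all _ fun x => ?_)
        simp only [div_eq_inv_mul x y]; ring
    _ = _ := by
      rw [h1, Complex.ofReal_inv, Complex.inv_cpow _ _ (by
        rw [Complex.arg_ofReal_of_nonneg hy'.le]; exact Real.pi_pos.ne), Complex.cpow_neg, inv_inv,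
        Complex.cpow_sub _ _ hyc, Complex.cpow_one]
      field_simp

/-- A criterion for an operator to be a Mellin convolution. -/
theorem actsAsMellinConvolution_of {A : (ℝ → ℂ) → ℝ → ℂ} {D : Set (ℝ → ℂ)} {k : ℝ → ℂ} {H : Set ℂ}
    (hk : Measurable k) (hks : ∀ s ∈ H, MellinConvergent k s)
    (hkC : ∀ s ∈ H, ∃ C, ∀ u : ℝ, 0 < u → ‖k u‖ ≤ C * u ^ (-s.re))
    (hA : ∀ s ∈ H, ∀ f ∈ D, MellinConvergent f s →
      ∀ᵐ x ∂(volume.restrict (Ioi (0 : ℝ))), A f x = f x + mellinConv k f x) :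
    ActsAsMellinConvolution A D k H := by
  refine fun s hs => ⟨hks s hs, fun f hfD hf => ?_⟩
  obtain ⟨C, hC⟩ := hkC s hs
  have hAf := hA s hs f hfD hf
  have hc := mellinConvergent_mellinConv hk (hks s hs) hf
  have hAf' : (fun x : ℝ => (x : ℂ) ^ (s - 1) • (f x + mellinConv k f x)) =ᵐ[volume.restrict
      (Ioi 0)] fun x : ℝ => (x : ℂ) ^ (s - 1) • A f x := by
    filter_upwards [hAf] with x hx
    rw [hx]
  refine ⟨fun x hx => integrableOn_mellinConv hk hC hf hx, hAf, ?_, ?_⟩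
  · refine (Integrable.add hf hc).congr (EventuallyEq.trans (ae_of_all _ fun x => ?_) hAf')
    simp only [Pi.add_apply, smul_add]
  · have : mellin (A f) s = ∫ x in Ioi (0 : ℝ), (x : ℂ) ^ (s - 1) • (f x + mellinConv k f x) :=
      (integral_congr_ae hAf').symm
    rw [this, multiplier, add_mul, one_mul, ← mellin_mellinConv hk (hks s hs) hf]
    simp only [smul_add]
    exact integral_add hf hc

/-! ### The kernels -/

/-- The kernel lives on `u > 1`, where `u^(-a) ≤ u^(-Re s)`; the strict inequality `Re s < a` gives
integrability at infinity. -/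
theorem mellinConvergent_and_bound_of_one_lt {k : ℝ → ℂ} {C a : ℝ} {s : ℂ} (hk : Measurable k)
    (hk0 : ∀ u : ℝ, u ≤ 1 → k u = 0) (hkb : ∀ u : ℝ, 1 < u → ‖k u‖ ≤ C * u ^ (-a))
    (hs : s.re < a) :
    MellinConvergent k s ∧ ∃ C, ∀ u : ℝ, 0 < u → ‖k u‖ ≤ C * u ^ (-s.re) := by
  constructor
  · have hm : Measurable fun t : ℝ => (t : ℂ) ^ (s - 1) := by fun_prop
    have h1 : IntegrableOn (fun t : ℝ => (t : ℂ) ^ (s - 1) • k t) (Ioi 1) := by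
      refine ((integrableOn_Ioi_rpow_of_lt (a := s.re - 1 - a) (by linarith)
        zero_lt_one).const_mul C).mono' (hm.smul hk).aestronglyMeasurable ?_
      filter_upwards [ae_restrict_mem measurableSet_Ioi] with u hu
      have hu0 : (0 : ℝ) < u := zero_lt_one.trans hu
      rw [norm_smul, norm_cpow_sub_one hu0, sub_eq_add_neg (s.re - 1), Real.rpow_add hu0,
        mul_left_comm]
      exact mul_le_mul_of_nonneg_left (hkb u hu) (by positivity)
    refine h1.of_forall_sdiff_eq_zero measurableSet_Ioi fun u hu => ?_
    rw [hk0 u (not_lt.1 hu.2), smul_zero]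
  · have hC : 0 ≤ C := by
      have := (norm_nonneg _).trans (hkb 2 (by norm_num))
      exact nonneg_of_mul_nonneg_left this (by positivity)
    refine ⟨C, fun u hu => ?_⟩
    rcases le_or_gt u 1 with h | h
    · rw [hk0 u h, norm_zero]; positivity
    · refine (hkb u h).trans (mul_le_mul_of_nonneg_left ?_ hC)
      exact Real.rpow_le_rpow_of_exponent_le h.le (by linarith)

theorem mellinConvergent_and_bound_of_lt_one {k : ℝ → ℂ} {C a : ℝ} {s : ℂ} (hk : Measurable k)
    (hk0 : ∀ u : ℝ, 1 ≤ u → k u = 0) (hkb : ∀ u : ℝ, 0 < u → u < 1 → ‖k u‖ ≤ C * u ^ (-a))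
    (hs : a < s.re) :
    MellinConvergent k s ∧ ∃ C, ∀ u : ℝ, 0 < u → ‖k u‖ ≤ C * u ^ (-s.re) := by
  constructor
  · have hm : Measurable fun t : ℝ => (t : ℂ) ^ (s - 1) := by fun_prop
    have h1 : IntegrableOn (fun t : ℝ => (t : ℂ) ^ (s - 1) • k t) (Ioo 0 1) := by
      refine (((intervalIntegral.integrableOn_Ioo_rpow_iff zero_lt_one).2
        (by linarith : -1 < s.re - 1 - a)).const_mul C).mono' (hm.smul hk).aestronglyMeasurable ?_
      filter_upwards [ae_restrict_mem measurableSet_Ioo] with u hu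
      rw [norm_smul, norm_cpow_sub_one hu.1, sub_eq_add_neg (s.re - 1), Real.rpow_add hu.1,
        mul_left_comm]
      exact mul_le_mul_of_nonneg_left (hkb u hu.1 hu.2) (Real.rpow_nonneg hu.1.le _)
    refine h1.of_forall_sdiff_eq_zero measurableSet_Ioi fun u hu => ?_
    rw [hk0 u (not_lt.1 fun h => hu.2 ⟨hu.1, h⟩), smul_zero]
  · have hC : 0 ≤ C := by
      have := (norm_nonneg _).trans (hkb (1 / 2) (by norm_num) (by norm_num))
      exact nonneg_of_mul_nonneg_left this (by positivity)
    refine ⟨C, fun u hu => ?_⟩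
    rcases le_or_gt 1 u with h | h
    · rw [hk0 u h, norm_zero]; positivity
    · refine (hkb u hu h).trans (mul_le_mul_of_nonneg_left ?_ hC)
      exact Real.rpow_le_rpow_of_exponent_ge hu h.le (by linarith)

theorem measurable_kerSzero (ν : ℂ) : Measurable (kerSzero ν) :=
  Measurable.ite measurableSet_Ioi (measurable_deriv _) measurable_const

theorem measurable_kerPzero (ν : ℂ) : Measurable (kerPzero ν) := by
  refine Measurable.ite measurableSet_Ioi ?_ measurable_const
  have := (measurable_deriv (legendreP ν)).comp
    (measurable_const.div measurable_id : Measurable fun u : ℝ => 1 / u)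
  exact (this.div Complex.measurable_ofReal).neg

theorem measurable_kerPminus (ν : ℂ) : Measurable (kerPminus ν) := by
  refine Measurable.ite measurableSet_Ioo ?_ measurable_const
  have := (measurable_deriv (legendreP ν)).comp
    (measurable_const.div measurable_id : Measurable fun u : ℝ => 1 / u)
  exact this.div Complex.measurable_ofReal

theorem measurable_kerSminus (ν : ℂ) : Measurable (kerSminus ν) :=
  Measurable.ite measurableSet_Ioo (measurable_deriv _).neg measurable_const

/-- The half-plane is exactly the condition that some growth exponent `r` of `P_ν` fits strictly
below `1 - Re s`; then `P_ν'(u) = O(u^(r-1))`. -/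
theorem kerSzero_convergent_and_bound (ν : ℂ) {s : ℂ} (hs : s ∈ halfSzero ν) :
    MellinConvergent (kerSzero ν) s ∧
      ∃ C, ∀ u : ℝ, 0 < u → ‖kerSzero ν u‖ ≤ C * u ^ (-s.re) := by
  obtain ⟨h1, h2⟩ := lt_min_iff.1 (show s.re < min (2 + ν.re) (1 - ν.re) from hs)
  obtain ⟨r, hr1, hr2⟩ := exists_between
    (max_lt (by linarith : ν.re < 1 - s.re) (by linarith : -1 - ν.re < 1 - s.re))
  obtain ⟨C, hC⟩ := exists_norm_legendre_le ν ((le_max_left _ _).trans_lt hr1)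
    ((le_max_right _ _).trans_lt hr1)
  refine mellinConvergent_and_bound_of_one_lt (C := C) (a := 1 - r) (measurable_kerSzero ν)
    (fun u hu => if_neg (not_lt.2 hu)) (fun u hu => ?_) (by linarith)
  rw [kerSzero, if_pos hu, deriv_legendreP ν (by linarith), neg_sub]
  exact (hC u hu.le).2

theorem kerPzero_convergent_and_bound (ν : ℂ) {s : ℂ} (hs : s ∈ halfPzero) :
    MellinConvergent (kerPzero ν) s ∧
      ∃ C, ∀ u : ℝ, 0 < u → ‖kerPzero ν u‖ ≤ C * u ^ (-s.re) := by
  obtain ⟨C, hC⟩ := exists_norm_legendre_le_of_le_one ν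
  refine mellinConvergent_and_bound_of_one_lt (C := C) (a := 1) (measurable_kerPzero ν)
    (fun u hu => if_neg (not_lt.2 hu)) (fun u hu => ?_) hs
  have hu0 : 0 < u := by linarith
  have hu1 : 0 < 1 / u := by positivity
  rw [kerPzero, if_pos hu, deriv_legendreP ν hu1, norm_neg, norm_div, Complex.norm_real,
    Real.norm_of_nonneg hu0.le, Real.rpow_neg_one, div_eq_mul_inv]
  have := (hC (1 / u) hu1 (by rw [div_le_one hu0]; exact hu.le)).2
  gcongr

theorem kerPminus_convergent_and_bound (ν : ℂ) {s : ℂ} (hs : s ∈ halfPminus ν) :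
    MellinConvergent (kerPminus ν) s ∧
      ∃ C, ∀ u : ℝ, 0 < u → ‖kerPminus ν u‖ ≤ C * u ^ (-s.re) := by
  obtain ⟨r, hr1, hr2⟩ := exists_between (show max ν.re (-1 - ν.re) < s.re from hs)
  obtain ⟨C, hC⟩ := exists_norm_legendre_le ν ((le_max_left _ _).trans_lt hr1)
    ((le_max_right _ _).trans_lt hr1)
  refine mellinConvergent_and_bound_of_lt_one (C := C) (a := r) (measurable_kerPminus ν)
    (fun u hu => if_neg fun h => absurd h.2 (not_lt.2 hu)) (fun u hu0 hu => ?_) hr2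
  have hu1 : 1 < 1 / u := by rwa [lt_div_iff₀ hu0, one_mul]
  rw [kerPminus, if_pos ⟨hu0, hu⟩, deriv_legendreP ν (by linarith), norm_div, Complex.norm_real,
    Real.norm_of_nonneg hu0.le, div_le_iff₀ hu0]
  refine ((hC (1 / u) hu1.le).2).trans (le_of_eq ?_)
  rw [one_div, Real.inv_rpow hu0.le, ← Real.rpow_neg hu0.le, mul_assoc]
  nth_rw 3 [← Real.rpow_one u]
  rw [← Real.rpow_add hu0]
  ring_nf

theorem kerSminus_convergent_and_bound (ν : ℂ) {s : ℂ} (hs : s ∈ halfSminus) :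
    MellinConvergent (kerSminus ν) s ∧
      ∃ C, ∀ u : ℝ, 0 < u → ‖kerSminus ν u‖ ≤ C * u ^ (-s.re) := by
  obtain ⟨C, hC⟩ := exists_norm_legendre_le_of_le_one ν
  refine mellinConvergent_and_bound_of_lt_one (C := C) (a := 0) (measurable_kerSminus ν)
    (fun u hu => if_neg fun h => absurd h.2 (not_lt.2 hu)) (fun u hu0 hu => ?_) hs
  rw [kerSminus, if_pos ⟨hu0, hu⟩, deriv_legendreP ν hu0, norm_neg, neg_zero, Real.rpow_zero,
    mul_one]
  exact (hC u hu0 hu.le).2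

/-! ### Absolutely continuous complex functions -/

/-- Applied to `Complex.re` and `Complex.im`, it reduces the fundamental theorem of calculus to real
functions. -/
theorem absolutelyContinuousOnInterval_comp_lipschitz {X Y : Type*} [PseudoMetricSpace X]
    [PseudoMetricSpace Y] {f : ℝ → X} {a b : ℝ} (hf : AbsolutelyContinuousOnInterval f a b)
    {φ : X → Y} (hφ : ∀ x y, dist (φ x) (φ y) ≤ dist x y) :
    AbsolutelyContinuousOnInterval (fun t => φ (f t)) a b := by
  rw [absolutelyContinuousOnInterval_iff] at hf ⊢
  intro ε hε
  obtain ⟨δ, hδ, h⟩ := hf ε hε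
  exact ⟨δ, hδ, fun E hE hd =>
    (Finset.sum_le_sum fun i _ => hφ _ _).trans_lt (h E hE hd)⟩

theorem ae_differentiableAt_of_absolutelyContinuous {f : ℝ → ℂ} {a b : ℝ}
    (hf : AbsolutelyContinuousOnInterval f a b) :
    ∀ᵐ x : ℝ, x ∈ uIcc a b → DifferentiableAt ℝ f x :=
  hf.boundedVariationOn.ae_differentiableAt_of_mem_uIcc

/-- The fundamental theorem of calculus for absolutely continuous complex functions. -/
theorem integral_deriv_of_absolutelyContinuous {f : ℝ → ℂ} {a b : ℝ}
    (hf : AbsolutelyContinuousOnInterval f a b) :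
    ∫ x in a..b, deriv f x = f b - f a := by
  have hre := absolutelyContinuousOnInterval_comp_lipschitz hf (φ := Complex.re) fun x y => by
    rw [Real.dist_eq, ← Complex.sub_re, Complex.dist_eq]; exact Complex.abs_re_le_norm _
  have him := absolutelyContinuousOnInterval_comp_lipschitz hf (φ := Complex.im) fun x y => by
    rw [Real.dist_eq, ← Complex.sub_im, Complex.dist_eq]; exact Complex.abs_im_le_norm _
  have h : ∫ x in a..b, deriv f x = ∫ x in a..b, (((deriv (fun t => (f t).re) x : ℝ) : ℂ) +
      ((deriv (fun t => (f t).im) x : ℝ) : ℂ) * Complex.I) := by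
    refine intervalIntegral.integral_congr_ae ?_
    filter_upwards [ae_differentiableAt_of_absolutelyContinuous hf] with x hx hx'
    have hd := (hx (uIoc_subset_uIcc hx')).hasDerivAt
    have h1 : HasDerivAt (fun t => (f t).re) (deriv f x).re x :=
      (Complex.reCLM.hasFDerivAt.comp_hasDerivAt x hd)
    have h2 : HasDerivAt (fun t => (f t).im) (deriv f x).im x :=
      (Complex.imCLM.hasFDerivAt.comp_hasDerivAt x hd)
    rw [h1.deriv, h2.deriv, Complex.re_add_im]
  have ire := hre.intervalIntegrable_deriv
  have iim := him.intervalIntegrable_deriv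
  have ire' : IntervalIntegrable (fun x => ((deriv (fun t => (f t).re) x : ℝ) : ℂ)) volume a b :=
    ⟨ire.1.ofReal, ire.2.ofReal⟩
  have iim' : IntervalIntegrable (fun x => ((deriv (fun t => (f t).im) x : ℝ) : ℂ)) volume a b :=
    ⟨iim.1.ofReal, iim.2.ofReal⟩
  rw [h, intervalIntegral.integral_add ire' (iim'.mul_const _), intervalIntegral.integral_mul_const,
    intervalIntegral.integral_ofReal, intervalIntegral.integral_ofReal,
    hre.integral_deriv_eq_sub, him.integral_deriv_eq_sub]
  apply Complex.ext <;> simp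

/-- Integration by parts of an absolutely continuous function against a `C¹` function. -/
theorem integral_mul_deriv_of_absolutelyContinuous {f g g' : ℝ → ℂ} {a b : ℝ}
    (hf : AbsolutelyContinuousOnInterval f a b) (hg : ∀ t ∈ uIcc a b, HasDerivAt g (g' t) t)
    (hg' : ContinuousOn g' (uIcc a b)) :
    ∫ t in a..b, (g t * deriv f t + g' t * f t) = g b * f b - g a * f a := by
  obtain ⟨C, hC⟩ := isCompact_uIcc.exists_bound_of_continuousOn hg'
  have hC0 : 0 ≤ C := (norm_nonneg _).trans (hC a left_mem_uIcc)
  -- A bounded derivative makes `g` Lipschitz, so the product with `f` is absolutely continuous and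
  -- its derivative can be integrated.
  have hgac : AbsolutelyContinuousOnInterval g a b := by
    refine LipschitzOnWith.absolutelyContinuousOnInterval (K := C.toNNReal)
      ((convex_uIcc a b).lipschitzOnWith_of_nnnorm_hasDerivWithin_le
        (fun t ht => (hg t ht).hasDerivWithinAt) fun t ht => ?_)
    rw [← NNReal.coe_le_coe, Real.coe_toNNReal _ hC0]
    exact hC t ht
  have h := integral_deriv_of_absolutelyContinuous (hgac.smul hf)
  simp only [Pi.smul_apply', smul_eq_mul] at h
  rw [← h]
  refine intervalIntegral.integral_congr_ae ?_
  filter_upwards [ae_differentiableAt_of_absolutelyContinuous hf] with t ht ht'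
  have h := (hg t (uIoc_subset_uIcc ht')).mul (ht (uIoc_subset_uIcc ht')).hasDerivAt
  rw [add_comm]
  exact h.deriv.symm

/-! ### The operators `₁P` -/

theorem hasDerivAt_legendreP_div (ν : ℂ) {x t : ℝ} (hx : 0 < x) (ht : 0 < t) :
    HasDerivAt (fun t => legendreP ν (t / x)) (legendreDeriv ν (t / x) / x) t := by
  convert! (hasDerivAt_legendreP ν (div_pos ht hx)).scomp t ((hasDerivAt_id t).div_const x) using 1
  rw [Complex.real_smul]; push_cast; simp [div_eq_inv_mul]

theorem continuousOn_legendreDeriv_div (ν : ℂ) {x : ℝ} (hx : 0 < x) :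
    ContinuousOn (fun t : ℝ => legendreDeriv ν (t / x) / x) (Ioi 0) :=
  ((continuousOn_legendreDeriv ν).comp (by fun_prop) fun _ ht => div_pos ht hx).div_const _

theorem integral_legendreP_mul_deriv (ν : ℂ) {f : ℝ → ℂ} (hf : LocallyAC f) {a b x : ℝ}
    (hx : 0 < x) (ha : 0 < a) (hab : a < b) :
    ∫ t in a..b, (legendreP ν (t / x) * deriv f t + legendreDeriv ν (t / x) / x * f t) =
      legendreP ν (b / x) * f b - legendreP ν (a / x) * f a := by
  have hsub : uIcc a b ⊆ Ioi 0 := fun t ht => by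
    rw [uIcc_of_le hab.le] at ht; exact ha.trans_le ht.1
  exact integral_mul_deriv_of_absolutelyContinuous (hf a b ha hab)
    (fun t ht => hasDerivAt_legendreP_div ν hx (hsub ht))
    ((continuousOn_legendreDeriv_div ν hx).mono hsub)

theorem integrableOn_and_integral_of_eq_indicator {φ ψ : ℝ → ℂ} {S : Set ℝ} (hS : MeasurableSet S)
    (hS0 : S ⊆ Ioi 0) (h : ∀ y : ℝ, 0 < y → φ y = S.indicator ψ y) (hφ : IntegrableOn φ (Ioi 0)) :
    IntegrableOn ψ S ∧ ∫ y in Ioi 0, φ y = ∫ y in S, ψ y := by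
  constructor
  · exact (hφ.mono_set hS0).congr_fun (fun y hy => by rw [h y (hS0 hy), indicator_of_mem hy]) hS
  · rw [setIntegral_congr_fun measurableSet_Ioi (fun y hy => h y hy),
      setIntegral_indicator hS, inter_eq_right.2 hS0]

/-- Integrate by parts on `[ε, x]` and let `ε → 0`. The term at `x` is `P_ν(1) f(x) = f(x)`, the one
at `ε` vanishes by the definition of the domain, and the kernel bound makes the integral with `P_ν'`
absolutely convergent. -/
theorem opPzero_eq (ν : ℂ) {s : ℂ} (hs : s ∈ halfPzero) {f : ℝ → ℂ} (hfD : f ∈ domPzero ν)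
    (hf : MellinConvergent f s) {x : ℝ} (hx : 0 < x) :
    opPzero ν f x = f x + mellinConv (kerPzero ν) f x := by
  obtain ⟨-, C, hC⟩ := kerPzero_convergent_and_bound ν hs
  obtain ⟨hac, hdom⟩ := hfD
  obtain ⟨hint, hlim⟩ := hdom x hx
  have hind : ∀ y : ℝ, 0 < y → kerPzero ν (x / y) * f y / (y : ℂ) =
      (Ioo 0 x).indicator (fun t => -(legendreDeriv ν (t / x) / x * f t)) y := by
    intro y hy
    have hyc : (y : ℂ) ≠ 0 := by exact_mod_cast hy.ne'
    have hxc : (x : ℂ) ≠ 0 := by exact_mod_cast hx.ne'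
    by_cases h : y < x
    · rw [indicator_of_mem (show y ∈ Ioo 0 x from ⟨hy, h⟩), kerPzero, if_pos (by rwa [one_lt_div hy]),
        one_div_div, deriv_legendreP ν (div_pos hy hx)]
      push_cast
      field_simp
    · rw [indicator_of_notMem (fun h' : y ∈ Ioo 0 x => h h'.2), kerPzero, if_neg (by rwa [one_lt_div hy])]
      simp
  obtain ⟨hi, he⟩ := integrableOn_and_integral_of_eq_indicator (S := Ioo 0 x)
    (ψ := fun t => -(legendreDeriv ν (t / x) / x * f t)) measurableSet_Ioo
    (fun y hy => hy.1) hind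
    (integrableOn_mellinConv (measurable_kerPzero ν) hC hf hx)
  rw [← integrableOn_Ioc_iff_integrableOn_Ioo] at hi
  rw [← integral_Ioc_eq_integral_Ioo] at he
  have hi' : IntegrableOn (fun t => legendreDeriv ν (t / x) / x * f t) (Ioc 0 x) := by
    simpa using! hi.neg
  set φ : ℝ → ℂ := fun t => legendreP ν (t / x) * deriv f t + legendreDeriv ν (t / x) / x * f t
  have hφ : IntegrableOn φ (Ioc 0 x) := hint.add hi'
  have hsum : ∫ t in Ioc 0 x, φ t = opPzero ν f x - mellinConv (kerPzero ν) f x := by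
    rw [mellinConv, he, integral_neg, sub_neg_eq_add]
    exact integral_add hint hi'
  have hcont := intervalIntegral.continuousOn_primitive_interval_left (μ := volume) (f := φ)
    (a := 0) (b := x) (by rwa [uIcc_of_le hx.le, integrableOn_Icc_iff_integrableOn_Ioc])
  rw [uIcc_of_le hx.le] at hcont
  have h1 : Tendsto (fun ε => ∫ t in ε..x, φ t) (𝓝[>] 0) (𝓝 (∫ t in (0 : ℝ)..x, φ t)) :=
    ((hcont 0 ⟨le_rfl, hx.le⟩).mono_left (nhdsWithin_le_of_mem (Icc_mem_nhdsGT hx)))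
  have h2 : Tendsto (fun ε => ∫ t in ε..x, φ t) (𝓝[>] 0) (𝓝 (f x - 0)) := by
    refine (hlim.const_sub (f x)).congr' ?_
    filter_upwards [Ioo_mem_nhdsGT hx] with ε hε
    rw [integral_legendreP_mul_deriv ν hac hx hε.1 hε.2, div_self hx.ne', legendreP_one, one_mul]
  have h3 := tendsto_nhds_unique h1 h2
  rw [intervalIntegral.integral_of_le hx.le, hsum, sub_zero] at h3
  linear_combination h3

/-- The same integration by parts on `[x, b]` with `b → ∞`. -/
theorem opPminus_eq (ν : ℂ) {s : ℂ} (hs : s ∈ halfPminus ν) {f : ℝ → ℂ} (hfD : f ∈ domPminus ν)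
    (hf : MellinConvergent f s) {x : ℝ} (hx : 0 < x) :
    opPminus ν f x = f x + mellinConv (kerPminus ν) f x := by
  obtain ⟨-, C, hC⟩ := kerPminus_convergent_and_bound ν hs
  obtain ⟨hac, hdom⟩ := hfD
  obtain ⟨hint, hlim⟩ := hdom x hx
  have hind : ∀ y : ℝ, 0 < y → kerPminus ν (x / y) * f y / (y : ℂ) =
      (Ioi x).indicator (fun t => legendreDeriv ν (t / x) / x * f t) y := by
    intro y hy
    have hyc : (y : ℂ) ≠ 0 := by exact_mod_cast hy.ne'
    have hxc : (x : ℂ) ≠ 0 := by exact_mod_cast hx.ne'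
    by_cases h : x < y
    · rw [indicator_of_mem (mem_Ioi.2 h), kerPminus,
        if_pos ⟨div_pos hx hy, by rwa [div_lt_one hy]⟩,
        one_div_div, deriv_legendreP ν (div_pos hy hx)]
      push_cast
      field_simp
    · rw [indicator_of_notMem (show y ∉ Ioi x from h), kerPminus, if_neg (by rw [div_lt_one hy]; tauto)]
      simp
  obtain ⟨hi, he⟩ := integrableOn_and_integral_of_eq_indicator (S := Ioi x)
    (ψ := fun t => legendreDeriv ν (t / x) / x * f t) measurableSet_Ioi
    (fun y hy => hx.trans hy) hind
    (integrableOn_mellinConv (measurable_kerPminus ν) hC hf hx)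
  have hint' : IntegrableOn (fun t => legendreP ν (t / x) * deriv f t) (Ioi x) := by
    simpa using! hint.neg
  set φ : ℝ → ℂ := fun t => legendreP ν (t / x) * deriv f t + legendreDeriv ν (t / x) / x * f t
  have hφ : IntegrableOn φ (Ioi x) := hint'.add hi
  have hsum : ∫ t in Ioi x, φ t = -opPminus ν f x + mellinConv (kerPminus ν) f x := by
    rw [mellinConv, he, opPminus]
    simp only [mul_neg, integral_neg, neg_neg]
    exact integral_add hint' hi
  have h1 := intervalIntegral_tendsto_integral_Ioi x hφ tendsto_id
  have h2 : Tendsto (fun b => ∫ t in x..b, φ t) atTop (𝓝 (0 - f x)) := by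
    refine (hlim.sub_const (f x)).congr' ?_
    filter_upwards [eventually_gt_atTop x] with b hb
    rw [integral_legendreP_mul_deriv ν hac hx hx hb, div_self hx.ne', legendreP_one, one_mul]
  have h3 := tendsto_nhds_unique h1 h2
  rw [hsum] at h3
  linear_combination -h3

theorem actsAsMellinConvolution_opPzero (ν : ℂ) :
    ActsAsMellinConvolution (opPzero ν) (domPzero ν) (kerPzero ν) halfPzero :=
  actsAsMellinConvolution_of (measurable_kerPzero ν)
    (fun _ hs => (kerPzero_convergent_and_bound ν hs).1)
    (fun _ hs => (kerPzero_convergent_and_bound ν hs).2) fun _ hs _ hfD hf => by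
      filter_upwards [ae_restrict_mem measurableSet_Ioi] with x hx using opPzero_eq ν hs hfD hf hx

theorem actsAsMellinConvolution_opPminus (ν : ℂ) :
    ActsAsMellinConvolution (opPminus ν) (domPminus ν) (kerPminus ν) (halfPminus ν) :=
  actsAsMellinConvolution_of (measurable_kerPminus ν)
    (fun _ hs => (kerPminus_convergent_and_bound ν hs).1)
    (fun _ hs => (kerPminus_convergent_and_bound ν hs).2) fun _ hs _ hfD hf => by
      filter_upwards [ae_restrict_mem measurableSet_Ioi] with x hx using opPminus_eq ν hs hfD hf hx

/-! ### The operators `₁S` -/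

theorem integrableOn_Icc_of_mellinConvergent {f : ℝ → ℂ} {s : ℂ} (hf : MellinConvergent f s)
    {a b : ℝ} (ha : 0 < a) : IntegrableOn f (Icc a b) := by
  have hsub : Icc a b ⊆ Ioi 0 := fun t ht => ha.trans_le ht.1
  have hc : ContinuousOn (fun t : ℝ => (t : ℂ) ^ (1 - s)) (Icc a b) := fun t ht =>
    (Complex.continuousAt_ofReal_cpow_const t _
      (Or.inr (ne_of_gt (hsub ht)))).continuousWithinAt
  refine ((hf.mono_set hsub).continuousOn_mul hc isCompact_Icc).congr_fun (fun t ht => ?_)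
    measurableSet_Icc
  have ht' : (t : ℂ) ≠ 0 := by exact_mod_cast (ne_of_gt (hsub ht))
  simp only [smul_eq_mul]
  rw [← mul_assoc, ← Complex.cpow_add _ _ ht']
  simp

theorem integrable_mellinConv_prod_Ioc {k f : ℝ → ℂ} {C : ℝ} {s : ℂ} (hk : Measurable k)
    (hkC : ∀ u : ℝ, 0 < u → ‖k u‖ ≤ C * u ^ (-s.re)) (hf : MellinConvergent f s) {a z : ℝ}
    (ha : 0 < a) :
    Integrable (fun p : ℝ × ℝ => k (p.1 / p.2) * f p.2 / (p.2 : ℂ))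
      ((volume.restrict (Ioc a z)).prod (volume.restrict (Ioi 0))) := by
  have h1 : IntegrableOn (fun x : ℝ => C * x ^ (-s.re)) (Ioc a z) := by
    refine (ContinuousOn.integrableOn_Icc (fun x hx => ?_)).mono_set Ioc_subset_Icc_self
    exact (continuousAt_const.mul (Real.continuousAt_rpow_const _ _
      (Or.inl (ha.trans_le hx.1).ne'))).continuousWithinAt
  refine (h1.mul_prod (integrableOn_rpow_mul_norm hf)).mono'
    (aestronglyMeasurable_mellinConv_integrand hk hf _) ?_
  rw [Measure.prod_restrict]
  filter_upwards [ae_restrict_mem (measurableSet_Ioc.prod measurableSet_Ioi)] with p hp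
  exact norm_mellinConv_integrand_le hkC (ha.trans hp.1.1) hp.2

/-- The hypothesis `hJ` says in integrated form that the derivative of `J` is `δ₁ + k`: the
indicator records the unit jump met when `w` passes `y`. Multiplying by `f y` and exchanging the
integrals gives the claim. -/
theorem integral_add_mellinConv_eq_sub {k f J : ℝ → ℂ} {C : ℝ} {s : ℂ} (hk : Measurable k)
    (hks : MellinConvergent k s) (hkC : ∀ u : ℝ, 0 < u → ‖k u‖ ≤ C * u ^ (-s.re))
    (hf : MellinConvergent f s)
    (hJ : ∀ a z y : ℝ, 0 < a → a < z → 0 < y → ∫ w in a..z, k (w / y) / y =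
      J (z / y) - J (a / y) - (Ioc a z).indicator 1 y)
    (hJf : ∀ x : ℝ, 0 < x → IntegrableOn (fun y => J (x / y) * f y) (Ioi 0)) {a z : ℝ}
    (ha : 0 < a) (haz : a < z) :
    ∫ w in a..z, (f w + mellinConv k f w) =
      (∫ y in Ioi 0, J (z / y) * f y) - ∫ y in Ioi 0, J (a / y) * f y := by
  have hfi : IntegrableOn f (Ioc a z) :=
    (integrableOn_Icc_of_mellinConvergent hf ha).mono_set Ioc_subset_Icc_self
  have hci : IntegrableOn (mellinConv k f) (Ioc a z) :=
    (integrableOn_Icc_of_mellinConvergent (mellinConvergent_mellinConv hk hks hf) ha).mono_set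
      Ioc_subset_Icc_self
  have hswap := integral_integral_swap (f := fun w y : ℝ => k (w / y) * f y / (y : ℂ))
    (integrable_mellinConv_prod_Ioc hk hkC hf (z := z) ha)
  have hinner : ∀ y ∈ Ioi (0 : ℝ), ∫ w in Ioc a z, k (w / y) * f y / (y : ℂ) =
      J (z / y) * f y - J (a / y) * f y - (Ioc a z).indicator f y := by
    intro y hy
    have h := hJ a z y ha haz hy
    rw [intervalIntegral.integral_of_le haz.le] at h
    calc _ = (∫ w in Ioc a z, k (w / y) / y) * f y := by
          rw [← integral_mul_const]
          refine integral_congr_ae (ae_of_all _ fun w => ?_)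
          simp only; ring
      _ = _ := by
        rw [h]
        by_cases hm : y ∈ Ioc a z
        · rw [indicator_of_mem hm, indicator_of_mem hm]; simp; ring
        · rw [indicator_of_notMem hm, indicator_of_notMem hm]; ring
  have hsub : Ioc a z ⊆ Ioi 0 := fun t ht => ha.trans ht.1
  rw [setIntegral_congr_fun measurableSet_Ioi hinner] at hswap
  have hind : IntegrableOn ((Ioc a z).indicator f) (Ioi 0) :=
    ((integrable_indicator_iff measurableSet_Ioc).2 hfi).integrableOn
  have hdiff : IntegrableOn (fun y => J (z / y) * f y - J (a / y) * f y) (Ioi 0) :=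
    (hJf z (ha.trans haz)).sub (hJf a ha)
  rw [integral_sub hdiff hind, integral_sub (hJf z (ha.trans haz)) (hJf a ha),
    setIntegral_indicator measurableSet_Ioc, inter_eq_right.2 hsub] at hswap
  rw [intervalIntegral.integral_of_le haz.le, integral_add hfi hci]
  simp only [mellinConv]
  rw [hswap]
  ring

/-- Lebesgue's differentiation theorem on the countably many intervals `[1/(n+1), n+1]`, which
exhaust the half-line; to the right of the left endpoint, `F` differs from the primitive by a
constant. -/
theorem ae_hasDerivAt_of_integral_eq_sub {F g : ℝ → ℂ}
    (hg : ∀ a b : ℝ, 0 < a → IntegrableOn g (Icc a b))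
    (hF : ∀ a z : ℝ, 0 < a → a < z → ∫ w in a..z, g w = F z - F a) :
    ∀ᵐ x ∂(volume.restrict (Ioi (0 : ℝ))), HasDerivAt F (g x) x := by
  rw [ae_restrict_iff' measurableSet_Ioi]
  have h : ∀ n : ℕ, ∀ᵐ x : ℝ, x ∈ uIcc (1 / (n + 1) : ℝ) (n + 1) →
      ∀ c ∈ uIcc (1 / (n + 1) : ℝ) (n + 1), HasDerivAt (fun x => ∫ t in c..x, g t) (g x) x := by
    intro n
    have hle : (1 / (n + 1) : ℝ) ≤ n + 1 := by
      rw [div_le_iff₀ (by positivity)]; nlinarith [(Nat.cast_nonneg n : (0 : ℝ) ≤ n)]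
    refine IntervalIntegrable.ae_hasDerivAt_integral ?_
    rw [intervalIntegrable_iff_integrableOn_Icc_of_le hle]
    exact hg _ _ (by positivity)
  filter_upwards [ae_all_iff.2 h] with x hx hx0
  have hx0' : (0 : ℝ) < x := hx0
  obtain ⟨n, hn⟩ := exists_nat_gt (max x (1 / x))
  obtain ⟨h1, h2⟩ := max_lt_iff.1 hn
  have h3 : (1 / (n + 1) : ℝ) < x := by
    rw [div_lt_iff₀ (by positivity)]
    rw [div_lt_iff₀ hx0'] at h2
    nlinarith
  have hxm : x ∈ uIcc (1 / (n + 1) : ℝ) (n + 1) := by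
    rw [uIcc_of_le (by linarith)]; exact ⟨h3.le, by linarith⟩
  refine ((hx n hxm _ left_mem_uIcc).add_const (F (1 / (n + 1)))).congr_of_eventuallyEq ?_
  filter_upwards [Ioi_mem_nhds h3] with y hy
  rw [hF _ _ (by positivity) hy, sub_add_cancel]

theorem ae_hasDerivAt_mellin_primitive {k f J : ℝ → ℂ} {C : ℝ} {s : ℂ} (hk : Measurable k)
    (hks : MellinConvergent k s) (hkC : ∀ u : ℝ, 0 < u → ‖k u‖ ≤ C * u ^ (-s.re))
    (hf : MellinConvergent f s)
    (hJ : ∀ a z y : ℝ, 0 < a → a < z → 0 < y → ∫ w in a..z, k (w / y) / y =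
      J (z / y) - J (a / y) - (Ioc a z).indicator 1 y)
    (hJf : ∀ x : ℝ, 0 < x → IntegrableOn (fun y => J (x / y) * f y) (Ioi 0)) :
    ∀ᵐ x ∂(volume.restrict (Ioi (0 : ℝ))), HasDerivAt
      (fun z => ∫ y in Ioi 0, J (z / y) * f y) (f x + mellinConv k f x) x :=
  ae_hasDerivAt_of_integral_eq_sub (fun _ _ ha => (integrableOn_Icc_of_mellinConvergent hf ha).add
    (integrableOn_Icc_of_mellinConvergent (mellinConvergent_mellinConv hk hks hf) ha))
    fun _ _ ha haz => integral_add_mellinConv_eq_sub hk hks hkC hf hJ hJf ha haz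

theorem hasDerivAt_legendreP_comp_div (ν : ℂ) {w y : ℝ} (hw : 0 < w) (hy : 0 < y) :
    HasDerivAt (fun w => legendreP ν (w / y)) (deriv (legendreP ν) (w / y) / y) w := by
  rw [deriv_legendreP ν (div_pos hw hy)]
  exact hasDerivAt_legendreP_div ν hy hw

/-- Freezing the argument with `max` gives a continuous primitive, differentiable except at `w = y`;
the jump is restored only in `J`. -/
theorem integral_kerSzero_div (ν : ℂ) {s : ℂ} (hs : s ∈ halfSzero ν) {a z y : ℝ} (ha : 0 < a)
    (haz : a < z) (hy : 0 < y) :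
    ∫ w in a..z, kerSzero ν (w / y) / y =
      legendreP ν (max (z / y) 1) - legendreP ν (max (a / y) 1) := by
  have hks := mellinConvergent_comp_div (kerSzero_convergent_and_bound ν hs).1 hy
  refine integral_eq_of_hasDerivAt_off_countable (fun w => legendreP ν (max (w / y) 1)) _
    (countable_singleton y) ?_ (fun w hw => ?_) ?_
  · exact (continuousOn_legendreP ν).comp (by fun_prop) fun w _ =>
      mem_Ioi.2 (zero_lt_one.trans_le (le_max_right _ _))
  · rw [min_eq_left haz.le, max_eq_right haz.le] at hw
    have hw0 : 0 < w := ha.trans hw.1.1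
    rcases lt_or_gt_of_ne (show w ≠ y from hw.2) with h | h
    · have h1 : ¬ 1 < w / y := by rw [one_lt_div hy]; exact h.le.not_gt
      rw [kerSzero, if_neg h1, zero_div]
      refine (hasDerivAt_const w (legendreP ν 1)).congr_of_eventuallyEq ?_
      filter_upwards [Iio_mem_nhds h] with v hv
      rw [max_eq_right ((div_le_one hy).2 (le_of_lt hv))]
    · have h1 : 1 < w / y := by rwa [one_lt_div hy]
      rw [kerSzero, if_pos h1]
      refine (hasDerivAt_legendreP_comp_div ν hw0 hy).congr_of_eventuallyEq ?_
      filter_upwards [Ioi_mem_nhds h] with v hv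
      rw [max_eq_left ((one_le_div hy).2 (le_of_lt hv))]
  · rw [intervalIntegrable_iff_integrableOn_Icc_of_le haz.le]
    exact (integrableOn_Icc_of_mellinConvergent hks ha).div_const _

theorem integral_kerSminus_div (ν : ℂ) {s : ℂ} (hs : s ∈ halfSminus) {a z y : ℝ} (ha : 0 < a)
    (haz : a < z) (hy : 0 < y) :
    ∫ w in a..z, kerSminus ν (w / y) / y =
      -legendreP ν (min (z / y) 1) - -legendreP ν (min (a / y) 1) := by
  have hks := mellinConvergent_comp_div (kerSminus_convergent_and_bound ν hs).1 hy
  refine integral_eq_of_hasDerivAt_off_countable (fun w => -legendreP ν (min (w / y) 1)) _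
    (countable_singleton y) ?_ (fun w hw => ?_) ?_
  · rw [uIcc_of_le haz.le]
    exact ((continuousOn_legendreP ν).comp (by fun_prop) fun w hw =>
      lt_min (div_pos (ha.trans_le hw.1) hy) zero_lt_one).neg
  · rw [min_eq_left haz.le, max_eq_right haz.le] at hw
    have hw0 : 0 < w := ha.trans hw.1.1
    rcases lt_or_gt_of_ne (show w ≠ y from hw.2) with h | h
    · have h1 : w / y < 1 := by rwa [div_lt_one hy]
      rw [kerSminus, if_pos ⟨div_pos hw0 hy, h1⟩, neg_div]
      refine (hasDerivAt_legendreP_comp_div ν hw0 hy).neg.congr_of_eventuallyEq ?_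
      filter_upwards [Iio_mem_nhds h] with v hv
      rw [min_eq_left ((div_le_one hy).2 (le_of_lt hv))]; rfl
    · have h1 : ¬ (0 < w / y ∧ w / y < 1) := by rw [div_lt_one hy]; intro h'; linarith [h'.2]
      rw [kerSminus, if_neg h1, zero_div]
      refine (hasDerivAt_const w (-legendreP ν 1)).congr_of_eventuallyEq ?_
      filter_upwards [Ioi_mem_nhds h] with v hv
      rw [min_eq_right ((one_le_div hy).2 (le_of_lt hv))]
  · rw [intervalIntegrable_iff_integrableOn_Icc_of_le haz.le]
    exact (integrableOn_Icc_of_mellinConvergent hks ha).div_const _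

theorem ae_hasDerivAt_Szero (ν : ℂ) {s : ℂ} (hs : s ∈ halfSzero ν) {f : ℝ → ℂ}
    (hfD : f ∈ domSzero ν) (hf : MellinConvergent f s) :
    ∀ᵐ x ∂(volume.restrict (Ioi (0 : ℝ))), HasDerivAt
      (fun z : ℝ => ∫ t in Ioc 0 z, legendreP ν (z / t) * f t)
      (f x + mellinConv (kerSzero ν) f x) x := by
  obtain ⟨hks, C, hC⟩ := kerSzero_convergent_and_bound ν hs
  -- `J` jumps at `1` from `0` to `P_ν(1) = 1`; the value at `1` itself matches the half-open
  -- interval in `hJ`.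
  set J : ℝ → ℂ := fun u => if 1 ≤ u then legendreP ν u else 0 with hJdef
  have hJind : ∀ z t : ℝ, 0 < z → 0 < t → J (z / t) * f t =
      (Ioc 0 z).indicator (fun t => legendreP ν (z / t) * f t) t := by
    intro z t hz ht
    by_cases h : t ≤ z
    · rw [indicator_of_mem (show t ∈ Ioc 0 z from ⟨ht, h⟩), hJdef]
      simp only [if_pos ((one_le_div ht).2 h)]
    · rw [indicator_of_notMem (fun h' : t ∈ Ioc 0 z => h h'.2), hJdef]
      simp only [if_neg (fun h' => h ((one_le_div ht).1 h')), zero_mul]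
  have hsub : ∀ z : ℝ, Ioc 0 z ⊆ Ioi 0 := fun z t ht => ht.1
  have hae := ae_hasDerivAt_mellin_primitive (J := J) (measurable_kerSzero ν) hks hC hf ?_ ?_
  · filter_upwards [hae, ae_restrict_mem measurableSet_Ioi] with x hx hx0
    refine hx.congr_of_eventuallyEq ?_
    filter_upwards [Ioi_mem_nhds hx0] with z hz
    rw [setIntegral_congr_fun measurableSet_Ioi (fun t ht => hJind z t hz ht),
      setIntegral_indicator measurableSet_Ioc, inter_eq_right.2 (hsub z)]
  · intro a z y ha haz hy
    rw [integral_kerSzero_div ν hs ha haz hy]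
    simp only [hJdef, one_le_div hy, indicator_apply, mem_Ioc, Pi.one_apply]
    rcases le_or_gt y a with h1 | h1
    · rw [if_pos h1, if_pos (h1.trans haz.le), if_neg (by intro h; linarith [h.1]),
        max_eq_left ((one_le_div hy).2 h1), max_eq_left ((one_le_div hy).2 (h1.trans haz.le)),
        sub_zero]
    · rw [if_neg h1.not_ge, max_eq_right ((div_le_one hy).2 h1.le), legendreP_one]
      rcases le_or_gt y z with h2 | h2
      · rw [if_pos h2, if_pos ⟨h1, h2⟩, max_eq_left ((one_le_div hy).2 h2), sub_zero]
      · rw [if_neg h2.not_ge, if_neg (fun h => h2.not_ge h.2), max_eq_right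
          ((div_le_one hy).2 h2.le), legendreP_one]
        simp
  · intro x hx
    refine IntegrableOn.congr_fun ?_ (fun t ht => (hJind x t hx ht).symm) measurableSet_Ioi
    exact ((integrable_indicator_iff measurableSet_Ioc).2 (hfD x hx)).integrableOn

theorem ae_hasDerivAt_Sminus (ν : ℂ) {s : ℂ} (hs : s ∈ halfSminus) {f : ℝ → ℂ}
    (hfD : f ∈ domSminus ν) (hf : MellinConvergent f s) :
    ∀ᵐ x ∂(volume.restrict (Ioi (0 : ℝ))), HasDerivAt
      (fun z : ℝ => ∫ t in Ioi z, legendreP ν (z / t) * f t)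
      (-(f x + mellinConv (kerSminus ν) f x)) x := by
  obtain ⟨hks, C, hC⟩ := kerSminus_convergent_and_bound ν hs
  -- The minus sign makes this jump, from `-P_ν(1) = -1` to `0`, again equal to `+1`.
  set J : ℝ → ℂ := fun u => if u < 1 then -legendreP ν u else 0 with hJdef
  have hJind : ∀ z t : ℝ, 0 < z → 0 < t → J (z / t) * f t =
      (Ioi z).indicator (fun t => -(legendreP ν (z / t) * f t)) t := by
    intro z t hz ht
    by_cases h : z < t
    · rw [indicator_of_mem (show t ∈ Ioi z from h), hJdef]
      simp only [if_pos ((div_lt_one ht).2 h), neg_mul]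
    · rw [indicator_of_notMem (show t ∉ Ioi z from h), hJdef]
      simp only [if_neg (fun h' => h ((div_lt_one ht).1 h')), zero_mul]
  have hae := ae_hasDerivAt_mellin_primitive (J := J) (measurable_kerSminus ν) hks hC hf ?_ ?_
  · filter_upwards [hae, ae_restrict_mem measurableSet_Ioi] with x hx hx0
    refine hx.neg.congr_of_eventuallyEq ?_
    filter_upwards [Ioi_mem_nhds hx0] with z hz
    have hsub : Ioi z ⊆ Ioi 0 := fun t ht => lt_trans (show 0 < z from hz) ht
    rw [Pi.neg_apply, setIntegral_congr_fun measurableSet_Ioi (fun t ht => hJind z t hz ht),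
      setIntegral_indicator measurableSet_Ioi, inter_eq_right.2 hsub, integral_neg, neg_neg]
  · intro a z y ha haz hy
    rw [integral_kerSminus_div ν hs ha haz hy]
    simp only [hJdef, div_lt_one hy, indicator_apply, mem_Ioc, Pi.one_apply]
    rcases le_or_gt y a with h1 | h1
    · rw [if_neg h1.not_gt, if_neg (h1.trans haz.le).not_gt, if_neg (by intro h; linarith [h.1]),
        min_eq_right ((one_le_div hy).2 h1), min_eq_right ((one_le_div hy).2 (h1.trans haz.le))]
      simp
    · rw [if_pos h1, min_eq_left ((div_le_one hy).2 h1.le)]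
      rcases le_or_gt y z with h2 | h2
      · rw [if_neg h2.not_gt, if_pos ⟨h1, h2⟩, min_eq_right ((one_le_div hy).2 h2), legendreP_one]
        ring
      · rw [if_pos h2, if_neg (fun h => h2.not_ge h.2), min_eq_left
          ((div_le_one hy).2 h2.le), sub_zero]
  · intro x hx
    refine IntegrableOn.congr_fun ?_ (fun t ht => (hJind x t hx ht).symm) measurableSet_Ioi
    exact ((integrable_indicator_iff measurableSet_Ioi).2 (hfD x hx).neg).integrableOn

theorem actsAsMellinConvolution_opSzero (ν : ℂ) :
    ActsAsMellinConvolution (opSzero ν) (domSzero ν) (kerSzero ν) (halfSzero ν) :=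
  actsAsMellinConvolution_of (measurable_kerSzero ν)
    (fun _ hs => (kerSzero_convergent_and_bound ν hs).1)
    (fun _ hs => (kerSzero_convergent_and_bound ν hs).2) fun _ hs _ hfD hf => by
      filter_upwards [ae_hasDerivAt_Szero ν hs hfD hf] with x hx using hx.deriv

theorem actsAsMellinConvolution_opSminus (ν : ℂ) :
    ActsAsMellinConvolution (opSminus ν) (domSminus ν) (kerSminus ν) halfSminus :=
  actsAsMellinConvolution_of (measurable_kerSminus ν)
    (fun _ hs => (kerSminus_convergent_and_bound ν hs).1)
    (fun _ hs => (kerSminus_convergent_and_bound ν hs).2) fun _ hs _ hfD hf => by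
      filter_upwards [ae_hasDerivAt_Sminus ν hs hfD hf] with x hx
      rw [opSminus, hx.deriv, neg_neg]

/-! ### Gamma ratios as infinite products -/

/-- At a pole `w = -m` both sides are `0`: the product in `GammaSeq` contains a zero factor once `n
≥ m`, and division by zero gives `0`. -/
theorem tendsto_inv_GammaSeq (w : ℂ) :
    Tendsto (fun n => (Complex.GammaSeq w n)⁻¹) atTop (𝓝 (Complex.Gamma w)⁻¹) := by
  by_cases hw : Complex.Gamma w = 0
  · obtain ⟨m, hm⟩ := (Complex.Gamma_eq_zero_iff w).1 hw
    rw [hw, inv_zero]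
    refine tendsto_const_nhds.congr' ?_
    filter_upwards [eventually_ge_atTop m] with n hn
    rw [Complex.GammaSeq, Finset.prod_eq_zero (Finset.mem_range.2 (Nat.lt_succ_of_le hn))
      (by rw [hm]; ring), div_zero, inv_zero]
  · exact (Complex.GammaSeq_tendsto_Gamma w).inv₀ hw

/-- Euler's limit for each factor. The hypothesis on the sums makes the powers of `n` cancel, and
the factorials cancel because there are two on each side. -/
theorem tendsto_prod_Gamma_ratio {a b x y : ℂ} (h : a + b = x + y) :
    Tendsto (fun n : ℕ => ∏ j ∈ Finset.range (n + 1),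
      ((a + j) * (b + j) / ((x + j) * (y + j)))) atTop
      (𝓝 (Complex.Gamma x * Complex.Gamma y / (Complex.Gamma a * Complex.Gamma b))) := by
  have hl := ((Complex.GammaSeq_tendsto_Gamma x).mul (Complex.GammaSeq_tendsto_Gamma y)).mul
    ((tendsto_inv_GammaSeq a).mul (tendsto_inv_GammaSeq b))
  rw [← mul_inv, ← div_eq_mul_inv] at hl
  refine hl.congr' ?_
  filter_upwards [eventually_ne_atTop 0] with n hn
  have hn' : (n : ℂ) ≠ 0 := Nat.cast_ne_zero.2 hn
  have hf : (n.factorial : ℂ) ≠ 0 := Nat.cast_ne_zero.2 n.factorial_ne_zero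
  have hp : (n : ℂ) ^ x * (n : ℂ) ^ y = (n : ℂ) ^ a * (n : ℂ) ^ b := by
    rw [← Complex.cpow_add _ _ hn', ← Complex.cpow_add _ _ hn', h]
  have h1 : (n : ℂ) ^ a ≠ 0 := by simp [Complex.cpow_eq_zero_iff, hn']
  have h2 : (n : ℂ) ^ b ≠ 0 := by simp [Complex.cpow_eq_zero_iff, hn']
  rw [Finset.prod_div_distrib, Finset.prod_mul_distrib, Finset.prod_mul_distrib]
  simp only [Complex.GammaSeq, inv_div]
  generalize ∏ j ∈ Finset.range (n + 1), (a + (j : ℂ)) = A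
  generalize ∏ j ∈ Finset.range (n + 1), (b + (j : ℂ)) = B
  generalize ∏ j ∈ Finset.range (n + 1), (x + (j : ℂ)) = X
  generalize ∏ j ∈ Finset.range (n + 1), (y + (j : ℂ)) = Y
  calc _ = ((n : ℂ) ^ x * (n : ℂ) ^ y) * (n.factorial * n.factorial * (A * B) / (X * Y)) /
        ((n : ℂ) ^ a * (n : ℂ) ^ b * (n.factorial * n.factorial)) := by
        simp only [div_eq_mul_inv, mul_inv]; ring
    _ = _ := by rw [hp]; field_simp

/-- A sequence that satisfies the recurrence of a gamma ratio and tends to `1` is the ratio. -/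
theorem eq_Gamma_ratio_of_recurrence {a b x y : ℂ} (h : a + b = x + y) {G : ℕ → ℂ}
    (hG : ∀ n : ℕ, G n = (a + n) * (b + n) / ((x + n) * (y + n)) * G (n + 1))
    (hlim : Tendsto G atTop (𝓝 1)) :
    G 0 = Complex.Gamma x * Complex.Gamma y / (Complex.Gamma a * Complex.Gamma b) := by
  have h1 : ∀ n : ℕ, G 0 =
      (∏ j ∈ Finset.range n, ((a + j) * (b + j) / ((x + j) * (y + j)))) * G n := by
    intro n
    induction n with
    | zero => simp
    | succ n ih => rw [ih, hG n, Finset.prod_range_succ]; ring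
  have h2 := (tendsto_prod_Gamma_ratio h).mul (hlim.comp (tendsto_add_atTop_nat 1))
  rw [mul_one] at h2
  refine tendsto_nhds_unique (tendsto_const_nhds.congr fun n => ?_) h2
  exact h1 (n + 1)

/-! ### The multipliers -/

/-- The combination is chosen so that, after Legendre's equation is used, the terms with `P_ν`
cancel; only the Mellin integrands of `P_ν'` at `s` and `s + 2` remain. -/
theorem hasDerivAt_mellin_primitive (ν s : ℂ) {u : ℝ} (hu : 0 < u) :
    HasDerivAt (fun u : ℝ => (s + 1) * ((u : ℂ) ^ s * ((1 - (u : ℂ) ^ 2) * legendreDeriv ν u)) +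
        ν * (ν + 1) * ((u : ℂ) ^ (s + 1) * legendreP ν u))
      (s * (s + 1) * ((u : ℂ) ^ (s - 1) * legendreDeriv ν u -
          (u : ℂ) ^ (s + 2 - 1) * legendreDeriv ν u) +
        ν * (ν + 1) * ((u : ℂ) ^ (s + 2 - 1) * legendreDeriv ν u)) u := by
  have huc : (u : ℂ) ≠ 0 := by exact_mod_cast hu.ne'
  have hpow : ∀ r : ℂ, HasDerivAt (fun u : ℝ => (u : ℂ) ^ r) (r * (u : ℂ) ^ (r - 1)) u := by
    intro r
    have h : HasDerivAt (fun z : ℝ => (z : ℂ)) 1 u := by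
      simpa using (hasDerivAt_id u).ofReal_comp
    have hs : (u : ℂ) ∈ Complex.slitPlane := Complex.ofReal_mem_slitPlane.2 hu
    convert! ((hasDerivAt_id (u : ℂ)).cpow_const (c := r) hs).scomp u h using 1
    rw [smul_eq_mul, id_eq]; ring
  have h1 := (((hpow s).mul (legendre_ode ν hu)).const_mul (s + 1)).add
    (((hpow (s + 1)).mul (hasDerivAt_legendreP ν hu)).const_mul (ν * (ν + 1)))
  convert! h1 using 1
  rw [show s + 2 - 1 = s + 1 by ring, add_sub_cancel_right, Complex.cpow_add _ _ huc,
    Complex.cpow_sub _ _ huc, Complex.cpow_one]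
  field_simp
  ring

/-- A step of `S` multiplies the integrand by `q < 1` on the support of `k`, so the integral dies
out by dominated convergence and the unit mass remains. It is used with `q = u²` and `q = u⁻²`. -/
theorem tendsto_mellin_geometric {k : ℝ → ℂ} {s : ℂ} (hk : Measurable k)
    (hks : MellinConvergent k s) {q : ℝ → ℝ} (hq : Measurable q)
    (hq1 : ∀ u : ℝ, 0 < u → k u ≠ 0 → 0 ≤ q u ∧ q u < 1) {S : ℕ → ℂ}
    (hS : ∀ n : ℕ, ∀ u : ℝ, 0 < u → (u : ℂ) ^ (S n - 1) = (u : ℂ) ^ (s - 1) * (q u : ℂ) ^ n) :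
    Tendsto (fun n => multiplier k (S n)) atTop (𝓝 1) := by
  have hm : Measurable fun t : ℝ => (t : ℂ) ^ (s - 1) := by fun_prop
  have hmain : Tendsto (fun n : ℕ => ∫ u in Ioi (0 : ℝ), (u : ℂ) ^ (s - 1) * (q u : ℂ) ^ n * k u)
      atTop (𝓝 (∫ u in Ioi (0 : ℝ), (0 : ℂ))) := by
    refine tendsto_integral_of_dominated_convergence _ (fun n => ?_) hks.norm (fun n => ?_) ?_
    · exact ((hm.mul ((Complex.measurable_ofReal.comp hq).pow_const n)).mul hk).aestronglyMeasurable
    · filter_upwards [ae_restrict_mem measurableSet_Ioi] with u hu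
      by_cases h : k u = 0
      · simp [h]
      · obtain ⟨h0, h1⟩ := hq1 u hu h
        rw [mul_right_comm, norm_mul, smul_eq_mul, norm_pow, Complex.norm_real,
          Real.norm_of_nonneg h0]
        exact mul_le_of_le_one_right (norm_nonneg _) (pow_le_one₀ h0 h1.le)
    · filter_upwards [ae_restrict_mem measurableSet_Ioi] with u hu
      by_cases h : k u = 0
      · simp [h]
      · obtain ⟨h0, h1⟩ := hq1 u hu h
        have := tendsto_pow_atTop_nhds_zero_of_norm_lt_one (x := (q u : ℂ))
          (by rwa [Complex.norm_real, Real.norm_of_nonneg h0])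
        simpa using (this.const_mul ((u : ℂ) ^ (s - 1))).mul_const (k u)
  rw [integral_zero] at hmain
  have h := hmain.const_add 1
  rw [add_zero] at h
  refine h.congr fun n => ?_
  rw [multiplier, mellin]
  congr 1
  refine setIntegral_congr_fun measurableSet_Ioi fun u hu => ?_
  simp only [smul_eq_mul]
  rw [hS n u hu]

theorem mellin_kerSminus (ν : ℂ) {s : ℂ} (hs : s ∈ halfSminus) :
    IntegrableOn (fun u : ℝ => (u : ℂ) ^ (s - 1) * legendreDeriv ν u) (Ioc 0 1) ∧
      mellin (kerSminus ν) s = -∫ u in Ioc (0 : ℝ) 1, (u : ℂ) ^ (s - 1) * legendreDeriv ν u := by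
  have hind : ∀ u : ℝ, 0 < u → (u : ℂ) ^ (s - 1) • kerSminus ν u =
      (Ioo 0 1).indicator (fun u : ℝ => -((u : ℂ) ^ (s - 1) * legendreDeriv ν u)) u := by
    intro u hu
    by_cases h : u ∈ Ioo 0 1
    · rw [indicator_of_mem h, kerSminus, if_pos (show 0 < u ∧ u < 1 from h), deriv_legendreP ν hu,
        smul_eq_mul, mul_neg]
    · rw [indicator_of_notMem h, kerSminus, if_neg (show ¬(0 < u ∧ u < 1) from h), smul_zero]
  obtain ⟨h1, h2⟩ := integrableOn_and_integral_of_eq_indicator measurableSet_Ioo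
    (fun y hy => hy.1) hind (kerSminus_convergent_and_bound ν hs).1
  rw [integrableOn_Ioc_iff_integrableOn_Ioo, mellin, h2, integral_Ioc_eq_integral_Ioo,
    integral_neg]
  exact ⟨by simpa using! h1.neg, rfl⟩

theorem mellin_kerSzero (ν : ℂ) {s : ℂ} (hs : s ∈ halfSzero ν) :
    IntegrableOn (fun u : ℝ => (u : ℂ) ^ (s - 1) * legendreDeriv ν u) (Ioi 1) ∧
      mellin (kerSzero ν) s = ∫ u in Ioi (1 : ℝ), (u : ℂ) ^ (s - 1) * legendreDeriv ν u := by
  have hind : ∀ u : ℝ, 0 < u → (u : ℂ) ^ (s - 1) • kerSzero ν u =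
      (Ioi 1).indicator (fun u : ℝ => (u : ℂ) ^ (s - 1) * legendreDeriv ν u) u := by
    intro u hu
    by_cases h : 1 < u
    · rw [indicator_of_mem (mem_Ioi.2 h), kerSzero, if_pos h, deriv_legendreP ν hu, smul_eq_mul]
    · rw [indicator_of_notMem (show u ∉ Ioi 1 from h), kerSzero, if_neg h, smul_zero]
  exact integrableOn_and_integral_of_eq_indicator measurableSet_Ioi
    (Ioi_subset_Ioi zero_le_one) hind (kerSzero_convergent_and_bound ν hs).1

theorem tendsto_ofReal_cpow_nhdsGT_zero {s : ℂ} (hs : 0 < s.re) :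
    Tendsto (fun u : ℝ => (u : ℂ) ^ s) (𝓝[>] 0) (𝓝 0) := by
  have h := (Complex.continuousAt_ofReal_cpow_const 0 s (Or.inl hs)).tendsto
  rw [Complex.ofReal_zero, Complex.zero_cpow (by intro h0; simp [h0] at hs)] at h
  exact h.mono_left nhdsWithin_le_nhds

/-- The primitive is evaluated on `(0, 1)`. It vanishes at `0` because `Re s > 0` and `P_ν`, `P_ν'`
are bounded; at `1` the factor `1 - u²` leaves only `ν (ν + 1)`. The `1` in `multiplier` absorbs
this constant, and `s (s + 1) - ν (ν + 1) = (s + ν + 1)(s - ν)`. -/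
theorem multiplier_kerSminus_recurrence (ν : ℂ) {s : ℂ} (hs : s ∈ halfSminus) :
    s * (s + 1) * multiplier (kerSminus ν) s =
      (s + ν + 1) * (s - ν) * multiplier (kerSminus ν) (s + 2) := by
  have hs0 : 0 < s.re := hs
  have hs2 : s + 2 ∈ halfSminus := by
    show 0 < (s + 2).re
    simp; linarith
  obtain ⟨hi1, h1⟩ := mellin_kerSminus ν hs
  obtain ⟨hi2, h2⟩ := mellin_kerSminus ν hs2
  obtain ⟨C, hC⟩ := exists_norm_legendre_le_of_le_one ν
  have hdiff : IntegrableOn (fun u : ℝ => s * (s + 1) * ((u : ℂ) ^ (s - 1) * legendreDeriv ν u -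
      (u : ℂ) ^ (s + 2 - 1) * legendreDeriv ν u)) (Ioc 0 1) := (hi1.sub hi2).const_mul _
  have hint := hdiff.add (hi2.const_mul (ν * (ν + 1)))
  have hbd : ∀ φ : ℝ → ℂ, (∀ z : ℝ, 0 < z → z ≤ 1 → ‖φ z‖ ≤ C) →
      IsBoundedUnder (· ≤ ·) (𝓝[>] 0) ((‖·‖) ∘ φ) := fun φ hφ =>
    ⟨C, eventually_map.2 (by
      filter_upwards [Ioo_mem_nhdsGT one_pos] with z hz using hφ z hz.1 hz.2.le)⟩
  have hP : Tendsto (fun u : ℝ => (u : ℂ) ^ (s + 1) * legendreP ν u) (𝓝[>] 0) (𝓝 0) :=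
    (tendsto_ofReal_cpow_nhdsGT_zero (by simp; linarith)).zero_mul_isBoundedUnder_le
      (hbd _ fun z h0 h1 => (hC z h0 h1).1)
  have hD : Tendsto (fun u : ℝ => (u : ℂ) ^ s * ((1 - (u : ℂ) ^ 2) * legendreDeriv ν u))
      (𝓝[>] 0) (𝓝 0) := by
    refine (tendsto_ofReal_cpow_nhdsGT_zero hs0).zero_mul_isBoundedUnder_le
      (hbd _ fun z h0 h1 => ?_)
    have : ‖(1 - (z : ℂ) ^ 2)‖ ≤ 1 := by
      rw [← Complex.ofReal_one, ← Complex.ofReal_pow, ← Complex.ofReal_sub, Complex.norm_real,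
        Real.norm_of_nonneg (by nlinarith)]
      nlinarith
    rw [norm_mul]
    exact (mul_le_of_le_one_left (norm_nonneg _) this).trans (hC z h0 h1).2
  have h := intervalIntegral.integral_eq_sub_of_hasDerivAt_of_tendsto (zero_lt_one (α := ℝ))
    (fun u hu => hasDerivAt_mellin_primitive ν s hu.1)
    ((intervalIntegrable_iff_integrableOn_Ioc_of_le zero_le_one).2 hint)
    ((hD.const_mul (s + 1)).add (hP.const_mul (ν * (ν + 1))))
    ((hasDerivAt_mellin_primitive ν s one_pos).continuousAt.tendsto.mono_left nhdsWithin_le_nhds)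
  rw [intervalIntegral.integral_of_le zero_le_one,
    integral_add hdiff (hi2.const_mul (ν * (ν + 1))),
    integral_const_mul, integral_const_mul, integral_sub hi1 hi2] at h
  simp only [legendreP_one, Complex.ofReal_one, Complex.one_cpow] at h
  rw [multiplier, multiplier, h1, h2]
  linear_combination -h

theorem multiplier_kerSzero_recurrence (ν : ℂ) {s : ℂ} (hs : s ∈ halfSzero ν) :
    (s - ν - 2) * (s + ν - 1) * multiplier (kerSzero ν) s =
      (s - 1) * (s - 2) * multiplier (kerSzero ν) (s - 2) := by
  obtain ⟨hs1, hs2⟩ := lt_min_iff.1 (show s.re < min (2 + ν.re) (1 - ν.re) from hs)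
  have hs' : s - 2 ∈ halfSzero ν := by
    show (s - 2).re < min (2 + ν.re) (1 - ν.re)
    refine lt_min ?_ ?_ <;> simp <;> linarith
  obtain ⟨hi1, h1⟩ := mellin_kerSzero ν hs'
  obtain ⟨hi2, h2⟩ := mellin_kerSzero ν hs
  obtain ⟨r, hr1, hr2⟩ := exists_between
    (max_lt (by linarith : ν.re < 1 - s.re) (by linarith : -1 - ν.re < 1 - s.re))
  obtain ⟨C, hC⟩ := exists_norm_legendre_le ν ((le_max_left _ _).trans_lt hr1)
    ((le_max_right _ _).trans_lt hr1)
  -- The primitive is taken at `s - 2`, so that the two exponents involved, `s - 2` and `s`, both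
  -- lie in this left half-plane.
  have hder := fun u hu => hasDerivAt_mellin_primitive ν (s - 2) (u := u) hu
  rw [sub_add_cancel] at hder
  have hdiff : IntegrableOn (fun u : ℝ => (s - 2) * (s - 2 + 1) *
      ((u : ℂ) ^ (s - 2 - 1) * legendreDeriv ν u - (u : ℂ) ^ (s - 1) * legendreDeriv ν u))
      (Ioi 1) := (hi1.sub hi2).const_mul _
  have hint := hdiff.add (hi2.const_mul (ν * (ν + 1)))
  -- Both boundary terms are `O(u^(Re s - 1 + r))`, and `r < 1 - Re s`.
  have hz : Tendsto (fun u : ℝ => C * u ^ (s.re - 1 + r)) atTop (𝓝 0) := by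
    have := (tendsto_rpow_neg_atTop (y := 1 - s.re - r) (by linarith)).const_mul C
    rw [mul_zero] at this
    exact this.congr fun u => by ring_nf
  have hP : Tendsto (fun u : ℝ => (u : ℂ) ^ (s - 2 + 1) * legendreP ν u) atTop (𝓝 0) := by
    refine squeeze_zero_norm' ?_ hz
    filter_upwards [eventually_ge_atTop 1] with u hu
    have hu0 : 0 < u := by linarith
    rw [norm_mul, Complex.norm_cpow_eq_rpow_re_of_pos hu0, Real.rpow_add hu0, mul_left_comm]
    have he : (s - 2 + 1).re = s.re - 1 := by simp; ring
    rw [he]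
    exact mul_le_mul_of_nonneg_left (hC u hu).1 (by positivity)
  have hD : Tendsto (fun u : ℝ => (u : ℂ) ^ (s - 2) * ((1 - (u : ℂ) ^ 2) * legendreDeriv ν u))
      atTop (𝓝 0) := by
    refine squeeze_zero_norm' ?_ hz
    filter_upwards [eventually_ge_atTop 1] with u hu
    have hu0 : 0 < u := by linarith
    have hn : ‖(1 - (u : ℂ) ^ 2)‖ ≤ u ^ (2 : ℝ) := by
      rw [← Complex.ofReal_one, ← Complex.ofReal_pow, ← Complex.ofReal_sub, Complex.norm_real,
        Real.norm_of_nonpos (by nlinarith), Real.rpow_two]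
      linarith
    rw [norm_mul, norm_mul, Complex.norm_cpow_eq_rpow_re_of_pos hu0]
    calc _ ≤ u ^ (s - 2).re * (u ^ (2 : ℝ) * (C * u ^ (r - 1))) := by
          have := (hC u hu).2
          gcongr
      _ = C * (u ^ (s - 2).re * u ^ (2 : ℝ) * u ^ (r - 1)) := by ring
      _ = _ := by
        rw [← Real.rpow_add hu0, ← Real.rpow_add hu0]
        congr 2; simp; ring
  have h := integral_Ioi_of_hasDerivAt_of_tendsto' (a := (1 : ℝ))
    (fun u hu => hder u (zero_lt_one.trans_le hu)) hint
    ((hD.const_mul (s - 2 + 1)).add (hP.const_mul (ν * (ν + 1))))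
  rw [integral_add hdiff (hi2.const_mul (ν * (ν + 1))),
    integral_const_mul, integral_const_mul, integral_sub hi1 hi2] at h
  simp only [legendreP_one, Complex.ofReal_one, Complex.one_cpow] at h
  rw [multiplier, multiplier, h1, h2]
  linear_combination -h

theorem multiplier_kerSminus (ν : ℂ) {s : ℂ} (hs : s ∈ halfSminus) :
    multiplier (kerSminus ν) s = gammaSminus ν s := by
  have hs0 : 0 < s.re := hs
  have hlim : Tendsto (fun n : ℕ => multiplier (kerSminus ν) (s + 2 * n)) atTop (𝓝 1) := by
    refine tendsto_mellin_geometric (measurable_kerSminus ν) (kerSminus_convergent_and_bound ν hs).1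
      (q := fun u => u ^ 2) (by fun_prop) (fun u hu h => ?_) (fun n u hu => ?_)
    · by_cases h1 : u < 1
      · exact ⟨by positivity, by nlinarith⟩
      · exact absurd (if_neg fun h' => h1 h'.2) h
    · have huc : (u : ℂ) ≠ 0 := by exact_mod_cast hu.ne'
      rw [show s + 2 * n - 1 = (s - 1) + ((2 * n : ℕ) : ℂ) by push_cast; ring,
        Complex.cpow_add _ _ huc, Complex.cpow_natCast, pow_mul]
      push_cast; rfl
  have h := eq_Gamma_ratio_of_recurrence (a := s / 2 + ν / 2 + 1 / 2) (b := s / 2 - ν / 2)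
    (x := s / 2) (y := s / 2 + 1 / 2) (by ring) (fun n => ?_) hlim
  · simpa [gammaSminus] using h
  · have hre : 0 < (s + 2 * n).re := by
      have : (0 : ℝ) ≤ 2 * n := by positivity
      simp; linarith
    have hrec := multiplier_kerSminus_recurrence ν (s := s + 2 * n) hre
    have e1 : s / 2 + (n : ℂ) ≠ 0 := fun h0 => by
      rw [show s + 2 * n = 2 * (s / 2 + n) by ring, h0] at hre; simp at hre
    have e2 : s / 2 + 1 / 2 + (n : ℂ) ≠ 0 := fun h0 => by
      rw [show s + 2 * n = 2 * (s / 2 + 1 / 2 + n) - 1 by ring, h0] at hre; simp at hre; linarith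
    rw [div_mul_eq_mul_div, eq_div_iff (mul_ne_zero e1 e2)]
    rw [show s + 2 * ((n + 1 : ℕ) : ℂ) = s + 2 * n + 2 by push_cast; ring]
    -- The `4` comes from halving both linear factors on each side.
    linear_combination hrec / 4

theorem multiplier_kerSzero (ν : ℂ) {s : ℂ} (hs : s ∈ halfSzero ν) :
    multiplier (kerSzero ν) s = gammaSzero ν s := by
  obtain ⟨hs1, hs2⟩ := lt_min_iff.1 (show s.re < min (2 + ν.re) (1 - ν.re) from hs)
  have hlim : Tendsto (fun n : ℕ => multiplier (kerSzero ν) (s - 2 * n)) atTop (𝓝 1) := by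
    refine tendsto_mellin_geometric (measurable_kerSzero ν) (kerSzero_convergent_and_bound ν hs).1
      (q := fun u => (u ^ 2)⁻¹) (by fun_prop) (fun u hu h => ?_) (fun n u hu => ?_)
    · by_cases h1 : 1 < u
      · exact ⟨by positivity, inv_lt_one_of_one_lt₀ (by nlinarith)⟩
      · exact absurd (if_neg h1) h
    · have huc : (u : ℂ) ≠ 0 := by exact_mod_cast hu.ne'
      rw [show s - 2 * n - 1 = (s - 1) - ((2 * n : ℕ) : ℂ) by push_cast; ring,
        Complex.cpow_sub _ _ huc, Complex.cpow_natCast, pow_mul, div_eq_mul_inv]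
      push_cast; rw [inv_pow]
  have h := eq_Gamma_ratio_of_recurrence (a := 1 / 2 - s / 2) (b := 1 - s / 2)
    (x := -s / 2 + ν / 2 + 1) (y := -s / 2 - ν / 2 + 1 / 2) (by ring) (fun n => ?_) hlim
  · simpa [gammaSzero] using h
  · have hn : (0 : ℝ) ≤ n := by positivity
    have hmem : s - 2 * n ∈ halfSzero ν := by
      show (s - 2 * n).re < min (2 + ν.re) (1 - ν.re)
      refine lt_min ?_ ?_ <;> simp <;> linarith
    have hrec := multiplier_kerSzero_recurrence ν hmem
    have e1 : -s / 2 + ν / 2 + 1 + (n : ℂ) ≠ 0 := fun h0 => by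
      have := congrArg Complex.re (show s = ν + 2 + 2 * n by linear_combination -2 * h0)
      simp at this; linarith
    have e2 : -s / 2 - ν / 2 + 1 / 2 + (n : ℂ) ≠ 0 := fun h0 => by
      have := congrArg Complex.re (show s = 1 - ν + 2 * n by linear_combination -2 * h0)
      simp at this; linarith
    rw [div_mul_eq_mul_div, eq_div_iff (mul_ne_zero e1 e2)]
    rw [show s - 2 * ((n + 1 : ℕ) : ℂ) = s - 2 * n - 2 by push_cast; ring]
    linear_combination hrec / 4

/-! ### Reflection `u ↦ 1/u` and the relations between the gamma ratios -/

theorem mellin_of_eq_comp_inv {k l : ℝ → ℂ} (h : ∀ u : ℝ, 0 < u → k u = (u : ℂ)⁻¹ * l u⁻¹) (s : ℂ) :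
    mellin k s = mellin l (1 - s) := by
  have h1 : mellin k s = mellin (fun u : ℝ => (u : ℂ) ^ (-1 : ℂ) • (fun u => l u⁻¹) u) s := by
    refine setIntegral_congr_fun measurableSet_Ioi fun u hu => ?_
    simp only [smul_eq_mul]
    rw [h u hu, Complex.cpow_neg_one]
  rw [h1, mellin_cpow_smul, mellin_comp_inv]
  congr 1; ring

theorem multiplier_kerPzero_eq (ν s : ℂ) :
    multiplier (kerPzero ν) s = multiplier (kerSminus ν) (1 - s) := by
  rw [multiplier, multiplier, mellin_of_eq_comp_inv (l := kerSminus ν) fun u hu => ?_]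
  by_cases h : 1 < u
  · rw [kerPzero, kerSminus, if_pos h, if_pos ⟨inv_pos.2 hu, inv_lt_one_of_one_lt₀ h⟩, one_div]
    field_simp
  · rw [kerPzero, kerSminus, if_neg h, if_neg fun h' => h ((inv_lt_one₀ hu).1 h'.2), mul_zero]

theorem multiplier_kerPminus_eq (ν s : ℂ) :
    multiplier (kerPminus ν) s = multiplier (kerSzero ν) (1 - s) := by
  rw [multiplier, multiplier, mellin_of_eq_comp_inv (l := kerSzero ν) fun u hu => ?_]
  by_cases h : u < 1
  · rw [kerPminus, kerSzero, if_pos ⟨hu, h⟩, if_pos ((one_lt_inv₀ hu).2 h), one_div]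
    field_simp
  · rw [kerPminus, kerSzero, if_neg fun h' => h h'.2, if_neg fun h' => h ((one_lt_inv₀ hu).1 h'),
      mul_zero]

theorem one_sub_mem_halfSzero {ν s : ℂ} (hs : s ∈ halfPminus ν) : 1 - s ∈ halfSzero ν := by
  obtain ⟨h1, h2⟩ := max_lt_iff.1 (show max ν.re (-1 - ν.re) < s.re from hs)
  show (1 - s).re < min (2 + ν.re) (1 - ν.re)
  refine lt_min ?_ ?_ <;> simp <;> linarith

theorem one_sub_mem_halfSminus {s : ℂ} (hs : s ∈ halfPzero) : 1 - s ∈ halfSminus := by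
  have h : s.re < 1 := hs
  show 0 < (1 - s).re
  simp only [Complex.sub_re, Complex.one_re]; linarith

theorem gammaPminus_eq_gammaSzero (ν s : ℂ) : gammaPminus ν s = gammaSzero ν (1 - s) := by
  rw [gammaPminus, gammaSzero]; ring_nf

theorem gammaPzero_eq_gammaSminus (ν s : ℂ) : gammaPzero ν s = gammaSminus ν (1 - s) := by
  rw [gammaPzero, gammaSminus]; ring_nf

/-- No exception is needed at poles and zeros: inverting a quotient respects the convention that
division by zero is `0`. -/
theorem gammaPzero_eq_one_div (ν s : ℂ) : gammaPzero ν s = 1 / gammaSzero ν s := by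
  rw [gammaPzero, gammaSzero, one_div_div]

theorem gammaPminus_eq_one_div (ν s : ℂ) : gammaPminus ν s = 1 / gammaSminus ν s := by
  rw [gammaPminus, gammaSminus, one_div_div]

/-- Legendre's duplication formula at `(1 - s)/2`, applied to the denominator. -/
theorem gammaSzero_eq_duplication (ν s : ℂ) :
    gammaSzero ν s = (2 : ℂ) ^ (-s) / ((√Real.pi : ℝ) : ℂ) *
      (Complex.Gamma (-s / 2 - ν / 2 + 1 / 2) * Complex.Gamma (-s / 2 + ν / 2 + 1) /
        Complex.Gamma (1 - s)) := by
  have h := Complex.Gamma_mul_Gamma_add_half (1 / 2 - s / 2)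
  rw [show 1 / 2 - s / 2 + 1 / 2 = 1 - s / 2 by ring, show 2 * (1 / 2 - s / 2) = 1 - s by ring,
    sub_sub_cancel] at h
  rw [gammaSzero, h, Complex.cpow_neg]
  simp only [div_eq_mul_inv, mul_inv]
  ring

/-- In the intersection of the half-planes all four arguments of `Γ` have positive real part. -/
theorem gammaSzero_ne_zero {ν s : ℂ} (hs : s ∈ halfSzero ν) (hs' : s ∈ halfPzero) :
    gammaSzero ν s ≠ 0 := by
  obtain ⟨h1, h2⟩ := lt_min_iff.1 (show s.re < min (2 + ν.re) (1 - ν.re) from hs)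
  have h3 : s.re < 1 := hs'
  refine div_ne_zero (mul_ne_zero ?_ ?_) (mul_ne_zero ?_ ?_) <;>
  · refine Complex.Gamma_ne_zero_of_re_pos ?_
    simp
    linarith

theorem gammaPminus_ne_zero {ν s : ℂ} (hs : s ∈ halfPminus ν) (hs' : s ∈ halfSminus) :
    gammaPminus ν s ≠ 0 := by
  rw [gammaPminus_eq_gammaSzero]
  have h : 0 < s.re := hs'
  exact gammaSzero_ne_zero (one_sub_mem_halfSzero hs)
    (show (1 - s).re < 1 by simpa using h)

/-! ### Meromorphic continuation -/

theorem meromorphic_Gamma_comp_affine (a b : ℂ) :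
    Meromorphic fun s : ℂ => Complex.Gamma (a * s + b) := by
  -- `1/Γ` is entire, and the inverse of a meromorphic function is meromorphic.
  have h : Meromorphic fun s : ℂ => (Complex.Gamma (a * s + b))⁻¹ := fun s =>
    ((Complex.differentiable_one_div_Gamma.comp
      (by fun_prop : Differentiable ℂ fun s : ℂ => a * s + b)).analyticAt s).meromorphicAt
  rw [show (fun s : ℂ => Complex.Gamma (a * s + b)) = (fun s => (Complex.Gamma (a * s + b))⁻¹)⁻¹ from
    funext fun s => (inv_inv _).symm]
  exact h.inv

theorem meromorphic_Gamma_ratio {g a b c d : ℂ → ℂ} (A B C D A' B' C' D' : ℂ)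
    (ha : ∀ s, a s = A * s + A') (hb : ∀ s, b s = B * s + B') (hc : ∀ s, c s = C * s + C')
    (hd : ∀ s, d s = D * s + D') (hg : ∀ s, g s = Complex.Gamma (a s) * Complex.Gamma (b s) /
      (Complex.Gamma (c s) * Complex.Gamma (d s))) : Meromorphic g := by
  have h := ((meromorphic_Gamma_comp_affine A A').mul (meromorphic_Gamma_comp_affine B B')).div
    ((meromorphic_Gamma_comp_affine C C').mul (meromorphic_Gamma_comp_affine D D'))
  have e : g = ((fun s => Complex.Gamma (A * s + A')) * fun s => Complex.Gamma (B * s + B')) /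
      ((fun s => Complex.Gamma (C * s + C')) * fun s => Complex.Gamma (D * s + D')) := by
    funext s
    rw [hg, ha, hb, hc, hd]
    rfl
  rw [e]
  exact h

theorem meromorphic_gammaSzero (ν : ℂ) : Meromorphic (gammaSzero ν) :=
  meromorphic_Gamma_ratio (-1 / 2) (-1 / 2) (-1 / 2) (-1 / 2) (ν / 2 + 1) (-ν / 2 + 1 / 2) (1 / 2) 1
    (fun _ => by ring) (fun _ => by ring) (fun _ => by ring) (fun _ => by ring) fun _ => rfl

theorem meromorphic_gammaSminus (ν : ℂ) : Meromorphic (gammaSminus ν) :=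
  meromorphic_Gamma_ratio (1 / 2) (1 / 2) (1 / 2) (1 / 2) 0 (1 / 2) (ν / 2 + 1 / 2) (-ν / 2)
    (fun _ => by ring) (fun _ => by ring) (fun _ => by ring) (fun _ => by ring) fun _ => rfl

theorem meromorphic_gammaPzero (ν : ℂ) : Meromorphic (gammaPzero ν) := by
  rw [show gammaPzero ν = (gammaSzero ν)⁻¹ from
    funext fun s => by rw [gammaPzero_eq_one_div, one_div]; rfl]
  exact (meromorphic_gammaSzero ν).inv

theorem meromorphic_gammaPminus (ν : ℂ) : Meromorphic (gammaPminus ν) := by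
  rw [show gammaPminus ν = (gammaSminus ν)⁻¹ from
    funext fun s => by rw [gammaPminus_eq_one_div, one_div]; rfl]
  exact (meromorphic_gammaSminus ν).inv

theorem multiplier_kerPzero (ν : ℂ) {s : ℂ} (hs : s ∈ halfPzero) :
    multiplier (kerPzero ν) s = gammaPzero ν s := by
  rw [multiplier_kerPzero_eq, multiplier_kerSminus ν (one_sub_mem_halfSminus hs),
    gammaPzero_eq_gammaSminus]

theorem multiplier_kerPminus (ν : ℂ) {s : ℂ} (hs : s ∈ halfPminus ν) :
    multiplier (kerPminus ν) s = gammaPminus ν s := by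
  rw [multiplier_kerPminus_eq, multiplier_kerSzero ν (one_sub_mem_halfSzero hs),
    gammaPminus_eq_gammaSzero]

end BuschmanErdelyi

theorem theorem17 (ν : ℂ) :
    -- the operators are Mellin convolutions
    (BuschmanErdelyi.ActsAsMellinConvolution (BuschmanErdelyi.opSzero ν)
        (BuschmanErdelyi.domSzero ν) (BuschmanErdelyi.kerSzero ν) (BuschmanErdelyi.halfSzero ν) ∧
      BuschmanErdelyi.ActsAsMellinConvolution (BuschmanErdelyi.opPzero ν)
        (BuschmanErdelyi.domPzero ν) (BuschmanErdelyi.kerPzero ν) BuschmanErdelyi.halfPzero ∧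
      BuschmanErdelyi.ActsAsMellinConvolution (BuschmanErdelyi.opPminus ν)
        (BuschmanErdelyi.domPminus ν) (BuschmanErdelyi.kerPminus ν)
        (BuschmanErdelyi.halfPminus ν) ∧
      BuschmanErdelyi.ActsAsMellinConvolution (BuschmanErdelyi.opSminus ν)
        (BuschmanErdelyi.domSminus ν) (BuschmanErdelyi.kerSminus ν) BuschmanErdelyi.halfSminus) ∧
    -- the derivatives in the definitions of the operators S exist almost everywhere
    ((∀ s ∈ BuschmanErdelyi.halfSzero ν, ∀ f ∈ BuschmanErdelyi.domSzero ν, MellinConvergent f s →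
        ∀ᵐ x ∂(volume.restrict (Ioi (0 : ℝ))), DifferentiableAt ℝ
          (fun z : ℝ => ∫ t in Ioc 0 z, BuschmanErdelyi.legendreP ν (z / t) * f t) x) ∧
      (∀ s ∈ BuschmanErdelyi.halfSminus, ∀ f ∈ BuschmanErdelyi.domSminus ν, MellinConvergent f s →
        ∀ᵐ x ∂(volume.restrict (Ioi (0 : ℝ))), DifferentiableAt ℝ
          (fun z : ℝ => ∫ t in Ioi z, BuschmanErdelyi.legendreP ν (z / t) * f t) x)) ∧
    -- the multipliers
    ((∀ s ∈ BuschmanErdelyi.halfSzero ν,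
        BuschmanErdelyi.multiplier (BuschmanErdelyi.kerSzero ν) s =
          BuschmanErdelyi.gammaSzero ν s ∧
        BuschmanErdelyi.multiplier (BuschmanErdelyi.kerSzero ν) s =
          (2 : ℂ) ^ (-s) / ((√Real.pi : ℝ) : ℂ) *
            (Complex.Gamma (-s / 2 - ν / 2 + 1 / 2) * Complex.Gamma (-s / 2 + ν / 2 + 1) /
              Complex.Gamma (1 - s))) ∧
      (∀ s ∈ BuschmanErdelyi.halfPzero,
        BuschmanErdelyi.multiplier (BuschmanErdelyi.kerPzero ν) s =
          BuschmanErdelyi.gammaPzero ν s) ∧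
      (∀ s ∈ BuschmanErdelyi.halfPminus ν,
        BuschmanErdelyi.multiplier (BuschmanErdelyi.kerPminus ν) s =
          BuschmanErdelyi.gammaPminus ν s) ∧
      (∀ s ∈ BuschmanErdelyi.halfSminus,
        BuschmanErdelyi.multiplier (BuschmanErdelyi.kerSminus ν) s =
          BuschmanErdelyi.gammaSminus ν s)) ∧
    -- reciprocity, on the common half-planes; both sides are nonzero there
    ((∀ s ∈ BuschmanErdelyi.halfPzero ∩ BuschmanErdelyi.halfSzero ν,
        BuschmanErdelyi.multiplier (BuschmanErdelyi.kerSzero ν) s ≠ 0 ∧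
        BuschmanErdelyi.multiplier (BuschmanErdelyi.kerPzero ν) s =
          1 / BuschmanErdelyi.multiplier (BuschmanErdelyi.kerSzero ν) s) ∧
      (∀ s ∈ BuschmanErdelyi.halfPminus ν ∩ BuschmanErdelyi.halfSminus,
        BuschmanErdelyi.multiplier (BuschmanErdelyi.kerSminus ν) s ≠ 0 ∧
        BuschmanErdelyi.multiplier (BuschmanErdelyi.kerPminus ν) s =
          1 / BuschmanErdelyi.multiplier (BuschmanErdelyi.kerSminus ν) s)) ∧
    -- reflection
    ((∀ s ∈ BuschmanErdelyi.halfPminus ν, 1 - s ∈ BuschmanErdelyi.halfSzero ν ∧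
        BuschmanErdelyi.multiplier (BuschmanErdelyi.kerPminus ν) s =
          BuschmanErdelyi.multiplier (BuschmanErdelyi.kerSzero ν) (1 - s)) ∧
      (∀ s ∈ BuschmanErdelyi.halfPzero, 1 - s ∈ BuschmanErdelyi.halfSminus ∧
        BuschmanErdelyi.multiplier (BuschmanErdelyi.kerPzero ν) s =
          BuschmanErdelyi.multiplier (BuschmanErdelyi.kerSminus ν) (1 - s))) ∧
    -- both kinds of relations for the meromorphic continuations to the whole plane
    ((Meromorphic (BuschmanErdelyi.gammaSzero ν) ∧ Meromorphic (BuschmanErdelyi.gammaPzero ν) ∧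
        Meromorphic (BuschmanErdelyi.gammaPminus ν) ∧
        Meromorphic (BuschmanErdelyi.gammaSminus ν)) ∧
      ∀ s : ℂ,
        BuschmanErdelyi.gammaPzero ν s = 1 / BuschmanErdelyi.gammaSzero ν s ∧
        BuschmanErdelyi.gammaPminus ν s = 1 / BuschmanErdelyi.gammaSminus ν s ∧
        BuschmanErdelyi.gammaPminus ν s = BuschmanErdelyi.gammaSzero ν (1 - s) ∧
        BuschmanErdelyi.gammaPzero ν s = BuschmanErdelyi.gammaSminus ν (1 - s)) := by
  
  open BuschmanErdelyi in
  refine ⟨⟨actsAsMellinConvolution_opSzero ν, actsAsMellinConvolution_opPzero ν,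
    actsAsMellinConvolution_opPminus ν, actsAsMellinConvolution_opSminus ν⟩,
    ⟨fun s hs f hfD hf => ?_, fun s hs f hfD hf => ?_⟩,
    ⟨fun s hs => ⟨multiplier_kerSzero ν hs, ?_⟩, fun s hs => multiplier_kerPzero ν hs,
      fun s hs => multiplier_kerPminus ν hs, fun s hs => multiplier_kerSminus ν hs⟩,
    ⟨fun s hs => ⟨?_, ?_⟩, fun s hs => ⟨?_, ?_⟩⟩,
    ⟨fun s hs => ⟨one_sub_mem_halfSzero hs, multiplier_kerPminus_eq ν s⟩,
      fun s hs => ⟨one_sub_mem_halfSminus hs, multiplier_kerPzero_eq ν s⟩⟩,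
    ⟨meromorphic_gammaSzero ν, meromorphic_gammaPzero ν, meromorphic_gammaPminus ν,
      meromorphic_gammaSminus ν⟩,
    fun s => ⟨gammaPzero_eq_one_div ν s, gammaPminus_eq_one_div ν s,
      gammaPminus_eq_gammaSzero ν s, gammaPzero_eq_gammaSminus ν s⟩⟩
  · filter_upwards [BuschmanErdelyi.ae_hasDerivAt_Szero ν hs hfD hf] with x hx
    exact hx.differentiableAt
  · filter_upwards [BuschmanErdelyi.ae_hasDerivAt_Sminus ν hs hfD hf] with x hx
    exact hx.differentiableAt
  · rw [BuschmanErdelyi.multiplier_kerSzero ν hs, BuschmanErdelyi.gammaSzero_eq_duplication]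
  · rw [BuschmanErdelyi.multiplier_kerSzero ν hs.2]
    exact BuschmanErdelyi.gammaSzero_ne_zero hs.2 hs.1
  · rw [BuschmanErdelyi.multiplier_kerSzero ν hs.2, BuschmanErdelyi.multiplier_kerPzero ν hs.1,
      BuschmanErdelyi.gammaPzero_eq_one_div]
  · rw [BuschmanErdelyi.multiplier_kerSminus ν hs.2]
    -- A zero here would make the reciprocal ratio `1 / 0 = 0`, but that ratio has been shown to be
    -- nonzero.
    intro h
    apply BuschmanErdelyi.gammaPminus_ne_zero hs.1 hs.2
    rw [BuschmanErdelyi.gammaPminus_eq_one_div, h, div_zero]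
  · rw [BuschmanErdelyi.multiplier_kerSminus ν hs.2, BuschmanErdelyi.multiplier_kerPminus ν hs.1,
      BuschmanErdelyi.gammaPminus_eq_one_div]
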